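/- Let $d \ge 1$ and let $F_1, \ldots, F_d$ be fixed finite simple graphs, no two of which are isomorphic. Let $(G_n)_{n \ge 1}$ be a sequence of finite simple graphs and let $(c_n)_{n \ge 1}$ be integers with $c_n \to \infty$. Suppose that the edges of $G_n$ are colored uniformly at random with $c_n$ colors, that is, each edge of $G_n$ receives each of the $c_n$ colors with probability $1/c_n$, independently of the other edges. Let $R(F_i, G_n)$ be the number of monochromatic copies of $F_i$ in $G_n$, that is, the number of (not necessarily induced) subgraphs of $G_n$ that are isomorphic to $F_i$ and all of whose edges have the same color. Suppose that for every $1 \le i \le d$ there is a constant $\lambda_i \ge 0$ such that $$\lim_{n \to \infty} \mathbb{E}\, R(F_i, G_n) = \lim_{n \to \infty} \operatorname{Var} R(F_i, G_n) = \lambda_i .$$ Then, as $n \to \infty$, $$\big(R(F_1, G_n), \ldots, R(F_d, G_n)\big) \xrightarrow{\ D\ } (Z_1, \ldots, Z_d),$$ where $Z_1 \sim \mathrm{Pois}(\lambda_1), \ldots, Z_d \sim \mathrm{Pois}(\lambda_d)$ are independent and $\mathrm{Pois}(0)$ is the point mass at $0$. -/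

import Mathlib

open MeasureTheory ProbabilityTheory Filter Topology
open scoped NNReal

namespace MonoCopies

/-- With the edges of `G` colored by `χ`, the subgraph `H` of `G` is monochromatic: all its edges
have the same color. -/
def IsMonochromatic {V κ : Type*} {G : SimpleGraph V} (χ : G.edgeSet → κ) (H : G.Subgraph) :
    Prop :=
  ∀ e e' : G.edgeSet, (e : Sym2 V) ∈ H.edgeSet → (e' : Sym2 V) ∈ H.edgeSet → χ e = χ e'

/-- The set of monochromatic copies of `F` in the edge-colored graph `(G, χ)`. As usual, a copy of
`F` in `G` is a (not necessarily induced) subgraph of `G` that is isomorphic to `F`. -/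
def monochromaticCopies {W V κ : Type*} (F : SimpleGraph W) (G : SimpleGraph V)
    (χ : G.edgeSet → κ) : Set G.Subgraph :=
  {H | Nonempty (F ≃g H.coe) ∧ IsMonochromatic χ H}

/-- `R(F, G)`: the number of monochromatic copies of `F` in the graph `G` whose edges are
colored by `χ`. -/
noncomputable def R {W V κ : Type*} (F : SimpleGraph W) (G : SimpleGraph V)
    (χ : G.edgeSet → κ) : ℕ :=
  (monochromaticCopies F G χ).ncard

/-- `X` is a uniformly random coloring of the edges of `G` with `c` colors: each edge receives
each color with probability `1 / c`, independently of the other edges. -/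
structure IsUniformEdgeColoring {V Ω : Type*} [MeasurableSpace Ω] (P : Measure Ω)
    (G : SimpleGraph V) (c : ℕ) (X : G.edgeSet → Ω → Fin c) : Prop where
  measurable : ∀ e, Measurable (X e)
  uniform : ∀ e a, P.real {ω | X e ω = a} = 1 / (c : ℝ)
  indep : iIndepFun X P

end MonoCopies

/-! A copy matters only through its edge set. A set `s` of edges is monochromatic with probability
c^(1-|s|), and two sets with at most one common edge are monochromatic independently: the common
edge keeps its color and the other edges must match it. For c ≥ 2, a pair with two or more common
edges has covariance at least half its joint probability. Hence Var − E → 0 forces `overlap`, the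
expected number of such monochromatic pairs of distinct copies of one graph, to vanish
(`overlap_le_of_variance`).

For copies of two different graphs, Cauchy–Schwarz over the common edge set reduces such pairs to
overlaps within each graph (`cross_le`), except for pairs with the same edge set. Since the graphs
are not isomorphic, these pairs differ in the number of isolated vertices. Moving an isolated vertex
gives a twin copy, so the pair is charged to `overlap`, unless `G` has boundedly many vertices; then
there are boundedly many copies, each monochromatic with probability at most 1/c (`coincidence_le`).
So the family of all copies of all `F i` has vanishing overlap.

Vanishing overlap gives the Poisson limit through characteristic functions. For a weighted count w =
∑ θ_α 1_α, the function φ(t) = E exp(itw) nearly solves φ' = q'φ with q(t) = ∑ p_α (exp(itθ_α) − 1).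
The obstacle is that a few edges may lie in many copies, so ∑ p_α p_β over meeting pairs need not be
small. The edges of weight above ε form a set H of bounded size, whose edges have distinct colors
with probability tending to 1; φ is restricted to this event. There a set with two edges in H is not
monochromatic, and the expected number of such monochromatic sets was negligible anyway; a set with
at most one edge in H is monochromatic independently of the coloring of H. Only meetings outside H
remain, and they cost O(ε) (`norm_expect_cexp_sub_le`). First n → ∞, then ε → 0. The weights θ = t_i
on the copies of `F i` yield the joint law.

If `F i` has at most one edge, its count is deterministic, so its limit is 0 and eventually there
are no copies. -/

namespace MonoCopies

/-! ### Averages over all colorings, and independence of monochromatic sets -/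

section Averages

open Finset
open scoped BigOperators

variable {E : Type*} [Fintype E] [DecidableEq E] {c : ℕ}

/-- The set `s` of edges is monochromatic under the coloring `χ`. -/
def Mono (s : Finset E) (χ : E → Fin c) : Prop := ∀ e ∈ s, ∀ e' ∈ s, χ e = χ e'

instance (s : Finset E) : DecidablePred (Mono (c := c) s) := fun χ => by
  unfold Mono; infer_instance

/-- The indicator that `s` is monochromatic. -/
def monoInd (s : Finset E) (χ : E → Fin c) : ℝ := if Mono s χ then 1 else 0

lemma monoInd_nonneg (s : Finset E) (χ : E → Fin c) : 0 ≤ monoInd s χ := by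
  unfold monoInd; split_ifs <;> norm_num

/-- The probability that a given set of edges is monochromatic. -/
noncomputable def monoProb (c : ℕ) (s : Finset E) : ℝ := ((c : ℝ)⁻¹) ^ (#s - 1)

omit [Fintype E] [DecidableEq E] in
lemma monoProb_nonneg (s : Finset E) : 0 ≤ monoProb c s := by unfold monoProb; positivity

omit [Fintype E] [DecidableEq E] in
lemma monoProb_le_inv (hc : 1 ≤ c) {s : Finset E} (hs : 2 ≤ #s) :
    monoProb c s ≤ (c : ℝ)⁻¹ := by
  unfold monoProb
  calc ((c : ℝ)⁻¹) ^ (#s - 1) ≤ ((c : ℝ)⁻¹) ^ 1 :=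
        pow_le_pow_of_le_one (by positivity)
          (inv_le_one_of_one_le₀ (by exact_mod_cast hc)) (by omega)
    _ = _ := pow_one _

variable {K : Type*} [Field K] [CharZero K]

omit [CharZero K] in
-- Exchanging the color of `f` with the spare color `a` is an involution on pairs (χ, a).
lemma sum_resample (f : E) (g : (E → Fin c) → K) :
    ∑ χ, ∑ a, g (Function.update χ f a) = c * ∑ χ, g χ := by
  have h : ∑ x : (E → Fin c) × Fin c, g (Function.update x.1 f x.2)
      = ∑ x : (E → Fin c) × Fin c, g x.1 := by
    refine Finset.sum_nbij' (fun x => (Function.update x.1 f x.2, x.1 f))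
      (fun x => (Function.update x.1 f x.2, x.1 f)) ?_ ?_ ?_ ?_ ?_ <;> simp
  rw [← Finset.sum_product', univ_product_univ, h, ← univ_product_univ, Finset.sum_product]
  simp [Finset.mul_sum]

/-- When `f` is resampled, exactly one of the `c` colors agrees with that of `e`. -/
lemma expect_ite_eq (hc : 1 ≤ c) {f e : E} (hfe : f ≠ e) (g : (E → Fin c) → K)
    (hg : ∀ χ a, g (Function.update χ f a) = g χ) :
    𝔼 χ, (if χ f = χ e then g χ else 0) = (c : K)⁻¹ * 𝔼 χ, g χ := by
  have hc' : (c : K) ≠ 0 := by exact_mod_cast (by omega : c ≠ 0)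
  have h := sum_resample f (fun χ : E → Fin c => if χ f = χ e then g χ else 0)
  have h2 : ∀ χ : E → Fin c, ∑ a, (if (Function.update χ f a) f = (Function.update χ f a) e
      then g (Function.update χ f a) else 0) = g χ := by
    intro χ
    simp [hg, Function.update_of_ne hfe.symm]
  simp only [h2] at h
  rw [Finset.expect_eq_sum_div_card, Finset.expect_eq_sum_div_card, h]
  field_simp

lemma expect_star (hc : 1 ≤ c) {e : E} (t : Finset E) (het : e ∉ t) (g : (E → Fin c) → K)
    (hg : ∀ f ∈ t, ∀ χ a, g (Function.update χ f a) = g χ) :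
    𝔼 χ, (if ∀ f ∈ t, χ f = χ e then g χ else 0) = (c : K)⁻¹ ^ #t * 𝔼 χ, g χ := by
  induction t using Finset.induction_on with
  | empty => simp
  | insert f t hft ih =>
    have hfe : f ≠ e := fun h => het (by simp [h])
    have h1 : ∀ χ : E → Fin c, (if ∀ f' ∈ insert f t, χ f' = χ e then g χ else 0)
        = if χ f = χ e then (if ∀ f' ∈ t, χ f' = χ e then g χ else 0) else 0 := by
      intro χ
      simp only [Finset.forall_mem_insert, ite_and]
    simp only [h1]
    rw [expect_ite_eq hc hfe, ih (fun h => het (by simp [h]))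
      (fun f' hf' => hg f' (by simp [hf'])), card_insert_of_notMem hft, pow_succ]
    · ring
    · intro χ a
      rw [hg f (by simp)]
      congr 1
      rw [Function.update_of_ne hfe.symm]
      apply propext
      refine forall₂_congr fun f' hf' => ?_
      rw [Function.update_of_ne (ne_of_mem_of_not_mem hf' hft)]

omit [Fintype E] in
lemma mono_iff {e : E} {s : Finset E} (he : e ∈ s) (χ : E → Fin c) :
    Mono s χ ↔ ∀ f ∈ s.erase e, χ f = χ e := by
  constructor
  · exact fun h f hf => h f (mem_of_mem_erase hf) e he
  · intro h f hf f' hf'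
    have key : ∀ x ∈ s, χ x = χ e := fun x hx => by
      by_cases hxe : x = e
      · rw [hxe]
      · exact h x (mem_erase.2 ⟨hxe, hx⟩)
    rw [key f hf, key f' hf']

/-- A monochromatic set is independent of functions of the other edges and of one edge of the
set. -/
lemma expect_mono_mul (hc : 1 ≤ c) {e : E} {s : Finset E} (he : e ∈ s) (g : (E → Fin c) → K)
    (hg : ∀ f ∈ s, f ≠ e → ∀ χ a, g (Function.update χ f a) = g χ) :
    𝔼 χ, (if Mono s χ then g χ else 0) = (c : K)⁻¹ ^ (#s - 1) * 𝔼 χ, g χ := by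
  simp only [mono_iff he]
  rw [← card_erase_of_mem he]
  exact expect_star hc _ (by simp) g
    (fun f hf => hg f (mem_of_mem_erase hf) (ne_of_mem_erase hf))

lemma expect_one_eq (hc : 1 ≤ c) : 𝔼 _χ : E → Fin c, (1 : K) = 1 := by
  have : Nonempty (Fin c) := ⟨⟨0, hc⟩⟩
  exact Finset.expect_const univ_nonempty 1

lemma expect_monoInd (hc : 1 ≤ c) {s : Finset E} (hs : s.Nonempty) :
    𝔼 χ, monoInd (c := c) s χ = monoProb c s := by
  obtain ⟨e, he⟩ := hs
  have := expect_mono_mul (K := ℝ) hc he (fun _ => 1) (by simp)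
  rw [expect_one_eq hc, mul_one] at this
  exact this

lemma monoInd_mul_of_inter (s t : Finset E) (h : (s ∩ t).Nonempty) (χ : E → Fin c) :
    monoInd s χ * monoInd t χ = monoInd (s ∪ t) χ := by
  obtain ⟨e, he⟩ := h
  have hs := (mem_inter.1 he).1
  have ht := (mem_inter.1 he).2
  have : Mono (s ∪ t) χ ↔ Mono s χ ∧ Mono t χ := by
    constructor
    · exact fun h => ⟨fun a ha b hb => h a (by simp [ha]) b (by simp [hb]),
        fun a ha b hb => h a (by simp [ha]) b (by simp [hb])⟩
    · rintro ⟨h1, h2⟩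
      have key : ∀ x ∈ s ∪ t, χ x = χ e := fun x hx =>
        (mem_union.1 hx).elim (fun h => h1 x h e hs) (fun h => h2 x h e ht)
      exact fun a ha b hb => (key a ha).trans (key b hb).symm
  unfold monoInd
  by_cases h1 : Mono s χ <;> by_cases h2 : Mono t χ <;> simp [this, h1, h2]

lemma expect_mul_of_inter (hc : 1 ≤ c) {s t : Finset E} (h : (s ∩ t).Nonempty) :
    𝔼 χ, monoInd (c := c) s χ * monoInd t χ = ((c : ℝ)⁻¹) ^ (#(s ∪ t) - 1) := by
  simp only [monoInd_mul_of_inter s t h]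
  rw [expect_monoInd hc (h.mono (inter_subset_left.trans subset_union_left))]
  rfl

lemma monoInd_update {s : Finset E} {f : E} (hf : f ∉ s) (χ : E → Fin c) (a : Fin c) :
    monoInd s (Function.update χ f a) = monoInd s χ := by
  unfold monoInd
  have : Mono s (Function.update χ f a) ↔ Mono s χ := by
    unfold Mono
    refine forall₂_congr fun e he => forall₂_congr fun e' he' => ?_
    rw [Function.update_of_ne (ne_of_mem_of_not_mem he hf),
      Function.update_of_ne (ne_of_mem_of_not_mem he' hf)]
  simp only [this]

/-- The common edge, if there is one, is the reference edge whose color the rest of `s` must match;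
that rest is disjoint from `t`. -/
lemma expect_mul_of_inter_le_one (hc : 1 ≤ c) {s t : Finset E} (hs : s.Nonempty)
    (ht : t.Nonempty) (h : #(s ∩ t) ≤ 1) :
    𝔼 χ, monoInd (c := c) s χ * monoInd t χ = monoProb c s * monoProb c t := by
  obtain ⟨e, he, hst⟩ : ∃ e ∈ s, ∀ f ∈ s, f ≠ e → f ∉ t := by
    by_cases h0 : (s ∩ t).Nonempty
    · obtain ⟨e, he⟩ := h0
      refine ⟨e, (mem_inter.1 he).1, fun f hf hfe hft => hfe ?_⟩
      exact card_le_one.1 h f (mem_inter.2 ⟨hf, hft⟩) e he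
    · obtain ⟨e, he⟩ := hs
      exact ⟨e, he, fun f hf _ hft => h0 ⟨f, mem_inter.2 ⟨hf, hft⟩⟩⟩
  have := expect_mono_mul (K := ℝ) hc he (monoInd t)
    (fun f hf hfe χ a => monoInd_update (hst f hf hfe) χ a)
  rw [expect_monoInd hc ht] at this
  rw [monoProb, ← this]
  refine expect_congr rfl fun χ _ => ?_
  unfold monoInd
  split_ifs <;> simp

lemma monoProb_mul_le (hc : 1 ≤ c) {s t : Finset E} (h : (s ∩ t).Nonempty) :
    monoProb c s * monoProb c t ≤ 𝔼 χ, monoInd (c := c) s χ * monoInd t χ := by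
  rw [expect_mul_of_inter hc h]
  unfold monoProb
  rw [← pow_add]
  apply pow_le_pow_of_le_one (by positivity) (inv_le_one_of_one_le₀ (by exact_mod_cast hc))
  have := card_union_add_card_inter s t
  have h1 : 1 ≤ #(s ∩ t) := h.card_pos
  have h2 : #(s ∩ t) ≤ #s := card_le_card inter_subset_left
  have h3 : #(s ∩ t) ≤ #t := card_le_card inter_subset_right
  omega

lemma expect_mul_nonneg (s t : Finset E) : 0 ≤ 𝔼 χ, monoInd (c := c) s χ * monoInd t χ :=
  expect_nonneg fun χ _ => mul_nonneg (monoInd_nonneg s χ) (monoInd_nonneg t χ)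

end Averages

/-! ### Stability of a linear differential equation -/

section Analytic

/-- The integrating factor exp(−q) turns the residual into the derivative of φ exp(−q). Inserting
and removing this factor costs exp(M) each. -/
lemma norm_sub_exp_mul_le {φ q φ' q' : ℝ → ℂ} {M r : ℝ} (hφ : ∀ t, HasDerivAt φ (φ' t) t)
    (hq : ∀ t, HasDerivAt q (q' t) t) (hr : ∀ t, ‖φ' t - q' t * φ t‖ ≤ r)
    (hM : ∀ t, ‖q t‖ ≤ M) (hq0 : q 0 = 0) :
    ‖φ 1 - Complex.exp (q 1) * φ 0‖ ≤ Real.exp (2 * M) * r := by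
  have hexp : ∀ t, ‖Complex.exp (-q t)‖ ≤ Real.exp M := fun t =>
    (Complex.norm_exp_le_exp_norm _).trans (Real.exp_le_exp.2 (by rw [norm_neg]; exact hM t))
  have hd : ∀ t, HasDerivAt (fun t => φ t * Complex.exp (-q t))
      (φ' t * Complex.exp (-q t) + φ t * (Complex.exp (-q t) * -q' t)) t := fun t =>
    (hφ t).mul ((hq t).neg.cexp)
  have h1 := norm_image_sub_le_of_norm_deriv_le_segment_01'
    (f := fun t => φ t * Complex.exp (-q t)) (C := Real.exp M * r)
    (fun t _ => (hd t).hasDerivWithinAt) (fun t _ => by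
      have : φ' t * Complex.exp (-q t) + φ t * (Complex.exp (-q t) * -q' t)
          = Complex.exp (-q t) * (φ' t - q' t * φ t) := by ring
      rw [this, norm_mul]
      exact mul_le_mul (hexp t) (hr t) (norm_nonneg _) (Real.exp_pos _).le)
  simp only [hq0, neg_zero, Complex.exp_zero, mul_one] at h1
  have h2 : φ 1 - Complex.exp (q 1) * φ 0
      = Complex.exp (q 1) * (φ 1 * Complex.exp (-q 1) - φ 0) := by
    have : Complex.exp (q 1) * Complex.exp (-q 1) = 1 := by rw [← Complex.exp_add]; simp
    linear_combination (-φ 1) * this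
  rw [h2, norm_mul, two_mul, Real.exp_add, mul_assoc]
  exact mul_le_mul ((Complex.norm_exp_le_exp_norm _).trans (Real.exp_le_exp.2 (hM 1))) h1
    (norm_nonneg _) (Real.exp_pos _).le

lemma norm_cexp_sub_cexp_le_two (x y : ℝ) :
    ‖Complex.exp (x * Complex.I) - Complex.exp (y * Complex.I)‖ ≤ 2 :=
  (norm_sub_le _ _).trans (by simp only [Complex.norm_exp_ofReal_mul_I]; norm_num)

end Analytic

/-! ### Approximate differential equation for the characteristic function -/

section Poisson

open Finset
open scoped BigOperators

variable {E : Type*} [Fintype E] [DecidableEq E] {c : ℕ}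
variable {A : Type*} [Fintype A] [DecidableEq A]

omit [Fintype A] [DecidableEq A] in
-- Either no member of `N` is monochromatic and the exponents agree, or the sum on the right is at
-- least 1 and the trivial bound 2 suffices. The size of the weights is irrelevant.
lemma norm_cexp_sub_le_sum (s : A → Finset E) (θ : A → ℝ) (N : Finset A) (t a b : ℝ)
    (χ : E → Fin c) (hab : a = b + ∑ β ∈ N, θ β * monoInd (s β) χ) :
    ‖Complex.exp ((t * a : ℝ) * Complex.I) - Complex.exp ((t * b : ℝ) * Complex.I)‖
      ≤ 2 * ∑ β ∈ N, monoInd (s β) χ := by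
  have hnn : ∀ β ∈ N, 0 ≤ monoInd (s β) χ := fun β _ => monoInd_nonneg _ _
  by_cases h : ∃ β ∈ N, Mono (s β) χ
  · obtain ⟨β, hβ, hm⟩ := h
    have h1 : (1 : ℝ) ≤ ∑ β ∈ N, monoInd (s β) χ := by
      have := single_le_sum hnn hβ
      simpa [monoInd, hm] using this
    linarith [norm_cexp_sub_cexp_le_two (t * a) (t * b)]
  · push Not at h
    have : ∑ β ∈ N, θ β * monoInd (s β) χ = 0 :=
      sum_eq_zero fun β hβ => by simp [monoInd, h β hβ]
    rw [hab, this, add_zero, sub_self, norm_zero]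
    exact mul_nonneg (by norm_num) (sum_nonneg hnn)

/-- The members of the family that meet `s α` outside `H`. -/
def nbr (s : A → Finset E) (H : Finset E) (α : A) : Finset A :=
  univ.filter fun β => (s β ∩ (s α \ H)).Nonempty

/-- The weighted number of monochromatic members of a family of edge sets. -/
def wsum (s : A → Finset E) (θ : A → ℝ) (χ : E → Fin c) : ℝ :=
  ∑ α, θ α * monoInd (s α) χ

/-- Dropping the neighbors of `α` from the weighted sum leaves a quantity that ignores the colors of
`s α` outside `H`, hence is independent of `s α` being monochromatic. The first error is the cost of
dropping them while `s α` is monochromatic, the second that of restoring them after factoring. -/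
lemma norm_expect_mono_sub_le (hc : 1 ≤ c) (s : A → Finset E) (θ : A → ℝ) (H : Finset E)
    (ψ : (E → Fin c) → ℝ) (hψ0 : ∀ χ, 0 ≤ ψ χ) (hψ1 : ∀ χ, ψ χ ≤ 1)
    (hψ : ∀ f ∉ H, ∀ χ a, ψ (Function.update χ f a) = ψ χ) (t : ℝ) (α : A)
    (h2 : 2 ≤ #(s α)) (hα : #(s α ∩ H) ≤ 1) :
    ‖𝔼 χ, (monoInd (s α) χ : ℂ) * (ψ χ * Complex.exp ((t * wsum s θ χ : ℝ) * Complex.I))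
      - monoProb c (s α) * Complex.exp ((t * θ α : ℝ) * Complex.I)
        * 𝔼 χ, (ψ χ * Complex.exp ((t * wsum s θ χ : ℝ) * Complex.I))‖
      ≤ 2 * ∑ β ∈ (nbr s H α).erase α, 𝔼 χ, monoInd (c := c) (s α) χ * monoInd (s β) χ
        + 2 * ∑ β ∈ nbr s H α, monoProb c (s α) * 𝔼 χ, monoInd (c := c) (s β) χ := by
  set N := nbr s H α with hN
  -- Two edges, at most one of them in `H`: `α` is its own neighbor, and its weight contributes the
  -- phase `u`.
  have hαN : α ∈ N := by
    have : (s α \ H).Nonempty := by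
      rw [← card_pos]
      have := card_sdiff_add_card_inter (s α) H
      omega
    obtain ⟨e, he⟩ := this
    exact mem_filter.2 ⟨mem_univ _, e, mem_inter.2 ⟨(mem_sdiff.1 he).1, he⟩⟩
  let w' : (E → Fin c) → ℝ := fun χ => ∑ β ∈ univ \ N, θ β * monoInd (s β) χ
  have hw : ∀ χ : E → Fin c, wsum s θ χ = w' χ + ∑ β ∈ N, θ β * monoInd (s β) χ := fun χ =>
    (sum_sdiff (subset_univ N)).symm
  have hw2 : ∀ χ : E → Fin c, Mono (s α) χ →
      wsum s θ χ = (θ α + w' χ) + ∑ β ∈ N.erase α, θ β * monoInd (s β) χ := by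
    intro χ hm
    rw [hw, ← add_sum_erase N _ hαN]
    simp only [monoInd, hm, if_true]
    ring
  have hw'inv : ∀ f ∈ s α, f ∉ H → ∀ χ a, w' (Function.update χ f a) = w' χ := by
    intro f hf hfH χ a
    refine sum_congr rfl fun β hβ => ?_
    rw [monoInd_update]
    intro hfβ
    exact (mem_sdiff.1 hβ).2
      (mem_filter.2 ⟨mem_univ _, f, mem_inter.2 ⟨hfβ, mem_sdiff.2 ⟨hf, hfH⟩⟩⟩)
  obtain ⟨e, he, heH⟩ : ∃ e ∈ s α, ∀ f ∈ s α, f ≠ e → f ∉ H := by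
    by_cases h0 : (s α ∩ H).Nonempty
    · obtain ⟨e, he⟩ := h0
      exact ⟨e, (mem_inter.1 he).1, fun f hf hfe hfH =>
        hfe (card_le_one.1 hα f (mem_inter.2 ⟨hf, hfH⟩) e he)⟩
    · obtain ⟨e, he⟩ : (s α).Nonempty := card_pos.1 (by omega)
      exact ⟨e, he, fun f hf _ hfH => h0 ⟨f, mem_inter.2 ⟨hf, hfH⟩⟩⟩
  let g : (E → Fin c) → ℂ := fun χ => ψ χ * Complex.exp ((t * w' χ : ℝ) * Complex.I)
  have hstar : 𝔼 χ, (monoInd (s α) χ : ℂ) * g χ = monoProb c (s α) * 𝔼 χ, g χ := by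
    have := expect_mono_mul (K := ℂ) hc he g (fun f hf hfe χ a => by
      simp only [g, hψ f (heH f hf hfe), hw'inv f hf (heH f hf hfe)])
    rw [show (monoProb c (s α) : ℂ) = (c : ℂ)⁻¹ ^ (#(s α) - 1) by simp [monoProb], ← this]
    refine expect_congr rfl fun χ _ => ?_
    unfold monoInd
    split_ifs <;> simp
  have hψn : ∀ χ, ‖(ψ χ : ℂ)‖ ≤ 1 := fun χ => by
    rw [Complex.norm_real, Real.norm_of_nonneg (hψ0 χ)]; exact hψ1 χ
  set u : ℂ := Complex.exp ((t * θ α : ℝ) * Complex.I) with hu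
  have hun : ‖u‖ = 1 := Complex.norm_exp_ofReal_mul_I _
  have key1 : ‖𝔼 χ, (monoInd (s α) χ : ℂ) *
        (ψ χ * Complex.exp ((t * wsum s θ χ : ℝ) * Complex.I))
      - u * 𝔼 χ, (monoInd (s α) χ : ℂ) * g χ‖
      ≤ 2 * ∑ β ∈ N.erase α, 𝔼 χ, monoInd (c := c) (s α) χ * monoInd (s β) χ := by
    rw [mul_expect, ← expect_sub_distrib, ← expect_sum_comm, mul_expect]
    refine (RCLike.norm_expect_le (K := ℂ)).trans (expect_le_expect fun χ _ => ?_)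
    by_cases hm : Mono (s α) χ
    · have hJ : monoInd (s α) χ = 1 := by simp [monoInd, hm]
      simp only [hJ, Complex.ofReal_one, one_mul, g]
      have hexp : u * Complex.exp ((t * w' χ : ℝ) * Complex.I)
          = Complex.exp ((t * (θ α + w' χ) : ℝ) * Complex.I) := by
        rw [hu, ← Complex.exp_add]; congr 1; push_cast; ring
      have : (ψ χ : ℂ) * Complex.exp ((t * wsum s θ χ : ℝ) * Complex.I)
          - u * (ψ χ * Complex.exp ((t * w' χ : ℝ) * Complex.I))
          = ψ χ * (Complex.exp ((t * wsum s θ χ : ℝ) * Complex.I)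
            - Complex.exp ((t * (θ α + w' χ) : ℝ) * Complex.I)) := by
        rw [← hexp]; ring
      rw [this, norm_mul]
      calc _ ≤ 1 * (2 * ∑ β ∈ N.erase α, monoInd (s β) χ) :=
            mul_le_mul (hψn χ) (norm_cexp_sub_le_sum s θ _ t _ _ χ (hw2 χ hm))
              (norm_nonneg _) zero_le_one
        _ = _ := one_mul _
    · simp [monoInd, hm]
  have key2 : ‖𝔼 χ, g χ - 𝔼 χ, (ψ χ * Complex.exp ((t * wsum s θ χ : ℝ) * Complex.I))‖
      ≤ 2 * ∑ β ∈ N, 𝔼 χ, monoInd (c := c) (s β) χ := by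
    rw [← expect_sub_distrib, ← expect_sum_comm, mul_expect]
    refine (RCLike.norm_expect_le (K := ℂ)).trans (expect_le_expect fun χ _ => ?_)
    rw [← mul_sub, norm_mul, norm_sub_rev]
    calc _ ≤ 1 * (2 * ∑ β ∈ N, monoInd (s β) χ) :=
          mul_le_mul (hψn χ) (norm_cexp_sub_le_sum s θ _ t _ _ χ (hw χ))
            (norm_nonneg _) zero_le_one
      _ = _ := one_mul _
  have hp := monoProb_nonneg (c := c) (s α)
  have key3 : ‖(monoProb c (s α) : ℂ) * u * (𝔼 χ, g χ
      - 𝔼 χ, (ψ χ * Complex.exp ((t * wsum s θ χ : ℝ) * Complex.I)))‖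
      ≤ 2 * ∑ β ∈ N, monoProb c (s α) * 𝔼 χ, monoInd (c := c) (s β) χ := by
    rw [norm_mul, norm_mul, hun, mul_one, Complex.norm_real, Real.norm_of_nonneg hp,
      ← mul_sum]
    calc _ ≤ monoProb c (s α) * _ := mul_le_mul_of_nonneg_left key2 hp
      _ = _ := by ring
  refine le_trans ?_ (add_le_add key1 key3)
  refine le_trans (le_of_eq ?_) (norm_add_le _ _)
  rw [hstar]
  congr 1
  ring

lemma norm_cexp_sub_one_le_two (x : ℝ) : ‖Complex.exp (x * Complex.I) - 1‖ ≤ 2 := by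
  simpa using norm_cexp_sub_cexp_le_two x 0

/-- Poisson approximation of the characteristic function restricted to the event `ψ`, which is
determined by the colors of the edges in `H` and on which members of the family with two edges
in `H` are not monochromatic. -/
lemma norm_expect_cexp_wsum_sub_le (hc : 1 ≤ c) (s : A → Finset E) (θ : A → ℝ) (H : Finset E)
    (ψ : (E → Fin c) → ℝ) (hψ0 : ∀ χ, 0 ≤ ψ χ) (hψ1 : ∀ χ, ψ χ ≤ 1)
    (hψ : ∀ f ∉ H, ∀ χ a, ψ (Function.update χ f a) = ψ χ)
    (hψm : ∀ χ α, 2 ≤ #(s α ∩ H) → monoInd (s α) χ * ψ χ = 0)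
    (h2 : ∀ α, 2 ≤ #(s α)) {Θ L b₁ b₂ b₃ : ℝ} (hθ : ∀ α, |θ α| ≤ Θ)
    (hL : ∑ α, monoProb c (s α) ≤ L)
    (hb₁ : ∑ α, ∑ β ∈ nbr s H α, monoProb c (s α) * monoProb c (s β) ≤ b₁)
    (hb₂ : ∑ α, ∑ β ∈ (nbr s H α).erase α,
      𝔼 χ, monoInd (c := c) (s α) χ * monoInd (s β) χ ≤ b₂)
    (hb₃ : ∑ α with 2 ≤ #(s α ∩ H), monoProb c (s α) ≤ b₃) (hΘ : 0 ≤ Θ) :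
    ‖𝔼 χ, (ψ χ * Complex.exp ((wsum s θ χ : ℝ) * Complex.I))
      - Complex.exp (∑ α, monoProb c (s α) * (Complex.exp (θ α * Complex.I) - 1))
        * 𝔼 χ, (ψ χ : ℂ)‖ ≤ Real.exp (4 * L) * (Θ * (2 * b₂ + 2 * b₁ + b₃)) := by
  -- The parameter t scales the weights: t = 0 is trivial and t = 1 is the claim.
  let φ : ℝ → ℂ := fun t => 𝔼 χ, (ψ χ * Complex.exp ((t * wsum s θ χ : ℝ) * Complex.I))
  let J : ℝ → A → ℂ := fun t α =>
    𝔼 χ, (monoInd (s α) χ : ℂ) * (ψ χ * Complex.exp ((t * wsum s θ χ : ℝ) * Complex.I))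
  let q : ℝ → ℂ := fun t =>
    ∑ α, monoProb c (s α) * (Complex.exp ((t * θ α : ℝ) * Complex.I) - 1)
  have hexpd : ∀ x t : ℝ, HasDerivAt (fun t : ℝ => Complex.exp ((t * x : ℝ) * Complex.I))
      (x * Complex.I * Complex.exp ((t * x : ℝ) * Complex.I)) t := by
    intro x t
    have h1 : HasDerivAt (fun t : ℝ => ((t * x : ℝ) : ℂ) * Complex.I) (x * Complex.I) t := by
      have := ((hasDerivAt_id t).mul_const x).ofReal_comp.mul_const Complex.I
      simpa using this
    convert h1.cexp using 1
    ring
  have hφd : ∀ t, HasDerivAt φ (∑ α, θ α * Complex.I * J t α) t := by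
    intro t
    have h1 : HasDerivAt φ (𝔼 χ, (ψ χ * (wsum s θ χ * Complex.I *
        Complex.exp ((t * wsum s θ χ : ℝ) * Complex.I)))) t := by
      simp only [φ, Finset.expect_eq_sum_div_card]
      refine HasDerivAt.div_const (HasDerivAt.fun_sum fun χ _ => ?_) _
      exact (hexpd _ t).const_mul _
    convert h1 using 1
    simp only [J, mul_expect]
    rw [← expect_sum_comm]
    refine expect_congr rfl fun χ _ => ?_
    conv_rhs => rw [show (wsum s θ χ : ℂ) = ∑ α, (θ α : ℂ) * (monoInd (s α) χ : ℂ) by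
      simp [wsum]]
    simp only [sum_mul, mul_sum]
    exact sum_congr rfl fun α _ => by ring
  have hqd : ∀ t, HasDerivAt q (∑ α, monoProb c (s α) *
      (θ α * Complex.I * Complex.exp ((t * θ α : ℝ) * Complex.I))) t := by
    intro t
    refine HasDerivAt.fun_sum fun α _ => ?_
    exact ((hexpd _ t).sub_const 1).const_mul _
  have hφn : ∀ t, ‖φ t‖ ≤ 1 := by
    intro t
    refine (RCLike.norm_expect_le (K := ℂ)).trans ?_
    rw [← expect_one_eq (E := E) (K := ℝ) hc]
    refine expect_le_expect fun χ _ => ?_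
    rw [norm_mul, Complex.norm_exp_ofReal_mul_I, mul_one, Complex.norm_real,
      Real.norm_of_nonneg (hψ0 χ)]
    exact hψ1 χ
  have hloc : ∀ t α, ‖J t α - monoProb c (s α) * Complex.exp ((t * θ α : ℝ) * Complex.I) * φ t‖
      ≤ (2 * ∑ β ∈ (nbr s H α).erase α, 𝔼 χ, monoInd (c := c) (s α) χ * monoInd (s β) χ
        + 2 * ∑ β ∈ nbr s H α, monoProb c (s α) * monoProb c (s β))
        + if 2 ≤ #(s α ∩ H) then monoProb c (s α) else 0 := by
    intro t α
    have hp := monoProb_nonneg (c := c) (s α)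
    -- With two edges in `H`, the factor `ψ` makes `J` vanish, and the error is the whole term of
    -- q'φ.
    split_ifs with hα
    · have hJ0 : J t α = 0 := expect_eq_zero fun χ _ => by
        rw [← mul_assoc, ← Complex.ofReal_mul, hψm χ α hα]; simp
      rw [hJ0, zero_sub, norm_neg, norm_mul, norm_mul, Complex.norm_exp_ofReal_mul_I, mul_one,
        Complex.norm_real, Real.norm_of_nonneg hp]
      have h3 : monoProb c (s α) * ‖φ t‖ ≤ monoProb c (s α) * 1 :=
        mul_le_mul_of_nonneg_left (hφn t) hp
      have h4 : 0 ≤ ∑ β ∈ (nbr s H α).erase α,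
          𝔼 χ, monoInd (c := c) (s α) χ * monoInd (s β) χ :=
        sum_nonneg fun β _ => expect_mul_nonneg _ _
      have h5 : 0 ≤ ∑ β ∈ nbr s H α, monoProb c (s α) * monoProb c (s β) :=
        sum_nonneg fun β _ => mul_nonneg hp (monoProb_nonneg _)
      linarith
    · have := norm_expect_mono_sub_le hc s θ H ψ hψ0 hψ1 hψ t α (h2 α) (by omega)
      rw [add_zero]
      convert this using 5 with β
      rw [expect_monoInd hc (card_pos.1 (by have := h2 β; omega))]
  have hr : ∀ t, ‖∑ α, θ α * Complex.I * J t α - (∑ α, monoProb c (s α) *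
      (θ α * Complex.I * Complex.exp ((t * θ α : ℝ) * Complex.I))) * φ t‖
      ≤ Θ * (2 * b₂ + 2 * b₁ + b₃) := by
    intro t
    have h1 : ∑ α, θ α * Complex.I * J t α - (∑ α, monoProb c (s α) *
      (θ α * Complex.I * Complex.exp ((t * θ α : ℝ) * Complex.I))) * φ t
      = ∑ α, θ α * Complex.I *
        (J t α - monoProb c (s α) * Complex.exp ((t * θ α : ℝ) * Complex.I) * φ t) := by
      rw [sum_mul, ← sum_sub_distrib]
      exact sum_congr rfl fun α _ => by ring
    rw [h1]
    calc _ ≤ ∑ α, Θ * ((2 * ∑ β ∈ (nbr s H α).erase α,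
            𝔼 χ, monoInd (c := c) (s α) χ * monoInd (s β) χ
          + 2 * ∑ β ∈ nbr s H α, monoProb c (s α) * monoProb c (s β))
          + if 2 ≤ #(s α ∩ H) then monoProb c (s α) else 0) := by
          refine norm_sum_le_of_le _ fun α _ => ?_
          rw [norm_mul, norm_mul, Complex.norm_I, mul_one, Complex.norm_real, Real.norm_eq_abs]
          exact mul_le_mul (hθ α) (hloc t α) (norm_nonneg _) hΘ
      _ ≤ _ := by
          rw [← mul_sum, sum_add_distrib, sum_add_distrib, ← mul_sum, ← mul_sum, ← sum_filter]
          exact mul_le_mul_of_nonneg_left (by linarith) hΘ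
  have hM : ∀ t, ‖q t‖ ≤ 2 * L := by
    intro t
    calc _ ≤ ∑ α, monoProb c (s α) * 2 := by
          refine norm_sum_le_of_le _ fun α _ => ?_
          rw [norm_mul, Complex.norm_real, Real.norm_of_nonneg (monoProb_nonneg _)]
          exact mul_le_mul_of_nonneg_left (norm_cexp_sub_one_le_two _) (monoProb_nonneg _)
      _ ≤ _ := by rw [← sum_mul]; linarith
  have := norm_sub_exp_mul_le hφd hqd hr hM (by simp [q])
  rw [show 4 * L = 2 * (2 * L) by ring]
  simpa [φ, q] using this

end Poisson

/-! ### Heavy edges, rainbow colorings and the Poisson approximation bound -/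

section HeavyEdges

open Finset
open scoped BigOperators

variable {E : Type*} [Fintype E] [DecidableEq E] {c : ℕ}
variable {A : Type*} [Fintype A] [DecidableEq A]

/-- The expected number of ordered pairs of distinct members of the family that share at least two
edges and are both monochromatic. -/
noncomputable def overlap (c : ℕ) (s : A → Finset E) : ℝ :=
  ∑ α, ∑ β with β ≠ α ∧ 2 ≤ #(s α ∩ s β), 𝔼 χ, monoInd (c := c) (s α) χ * monoInd (s β) χ

lemma overlap_nonneg (s : A → Finset E) : 0 ≤ overlap c s :=
  sum_nonneg fun _ _ => sum_nonneg fun _ _ => expect_mul_nonneg _ _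

/-- The expected number of monochromatic members of the family that contain the edge `f`. -/
noncomputable def edgeWeight (c : ℕ) (s : A → Finset E) (f : E) : ℝ :=
  ∑ α with f ∈ s α, monoProb c (s α)

omit [Fintype E] [DecidableEq A] in
lemma edgeWeight_nonneg (s : A → Finset E) (f : E) : 0 ≤ edgeWeight c s f :=
  sum_nonneg fun _ _ => monoProb_nonneg _

omit [DecidableEq A] in
lemma sum_edgeWeight_le (s : A → Finset E) {m : ℕ} (hm : ∀ α, #(s α) ≤ m) {L : ℝ}
    (hL : ∑ α, monoProb c (s α) ≤ L) : ∑ f, edgeWeight c s f ≤ m * L := by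
  calc ∑ f, edgeWeight c s f = ∑ α, #(s α) * monoProb c (s α) := by
        simp only [edgeWeight, sum_filter]
        rw [sum_comm]
        refine sum_congr rfl fun α _ => ?_
        rw [← sum_filter, sum_const, nsmul_eq_mul]
        simp
    _ ≤ ∑ α, m * monoProb c (s α) := sum_le_sum fun α _ =>
        mul_le_mul_of_nonneg_right (by exact_mod_cast hm α) (monoProb_nonneg _)
    _ ≤ m * L := by
        rw [← mul_sum]; exact mul_le_mul_of_nonneg_left hL (Nat.cast_nonneg _)

/-- The edges of weight more than `ε`. -/
noncomputable def heavy (c : ℕ) (s : A → Finset E) (ε : ℝ) : Finset E :=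
  univ.filter fun f => ε < edgeWeight c s f

omit [DecidableEq A] in
lemma card_heavy_mul_le (s : A → Finset E) {m : ℕ} (hm : ∀ α, #(s α) ≤ m) {L ε : ℝ}
    (hL : ∑ α, monoProb c (s α) ≤ L) : #(heavy c s ε) * ε ≤ m * L := by
  calc (#(heavy c s ε) : ℝ) * ε = ∑ f ∈ heavy c s ε, ε := by simp
    _ ≤ ∑ f ∈ heavy c s ε, edgeWeight c s f :=
        sum_le_sum fun f hf => (mem_filter.1 hf).2.le
    _ ≤ ∑ f, edgeWeight c s f :=
        sum_le_sum_of_subset_of_nonneg (subset_univ _) fun f _ _ => edgeWeight_nonneg s f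
    _ ≤ m * L := sum_edgeWeight_le s hm hL

omit [DecidableEq A] in
-- Each neighboring pair is charged to a common light edge, which gives the sum of squared weights
-- of light edges; one factor is at most ε.
lemma sum_nbr_heavy_le (s : A → Finset E) {m : ℕ} (hm : ∀ α, #(s α) ≤ m) {L ε : ℝ}
    (hε : 0 ≤ ε) (hL : ∑ α, monoProb c (s α) ≤ L) :
    ∑ α, ∑ β ∈ nbr s (heavy c s ε) α, monoProb c (s α) * monoProb c (s β) ≤ ε * (m * L) := by
  set H := heavy c s ε
  calc _ ≤ ∑ α, ∑ β, ∑ f with f ∉ H,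
        (if f ∈ s α then monoProb c (s α) else 0) * (if f ∈ s β then monoProb c (s β) else 0) := by
        refine sum_le_sum fun α _ => ?_
        rw [nbr, sum_filter]
        refine sum_le_sum fun β _ => ?_
        have hnn : ∀ f, 0 ≤ (if f ∈ s α then monoProb c (s α) else 0) *
            (if f ∈ s β then monoProb c (s β) else 0) := fun f => by
          have h1 := monoProb_nonneg (c := c) (s α)
          have h2 := monoProb_nonneg (c := c) (s β)
          split_ifs <;> positivity
        split_ifs with h
        · obtain ⟨f, hf⟩ := h
          have h1 := mem_inter.1 hf
          have h2 := mem_sdiff.1 h1.2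
          have := single_le_sum (f := fun f => (if f ∈ s α then monoProb c (s α) else 0) *
            (if f ∈ s β then monoProb c (s β) else 0)) (s := univ.filter fun f => f ∉ H)
            (fun f _ => hnn f) (mem_filter.2 ⟨mem_univ f, h2.2⟩)
          simpa [h1.1, h2.1] using this
        · exact sum_nonneg fun f _ => hnn f
    _ = ∑ f with f ∉ H, edgeWeight c s f * edgeWeight c s f := by
        have : ∀ f, edgeWeight c s f * edgeWeight c s f = ∑ α, ∑ β,
          (if f ∈ s α then monoProb c (s α) else 0) *
            (if f ∈ s β then monoProb c (s β) else 0) := fun f => by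
          rw [edgeWeight, sum_filter, sum_mul_sum]
        simp only [this]
        symm
        rw [sum_comm]
        exact sum_congr rfl fun α _ => sum_comm
    _ ≤ ∑ f with f ∉ H, ε * edgeWeight c s f := by
        refine sum_le_sum fun f hf => mul_le_mul_of_nonneg_right ?_ (edgeWeight_nonneg s f)
        have := (mem_filter.1 hf).2
        simpa [H, heavy] using this
    _ ≤ ∑ f, ε * edgeWeight c s f :=
        sum_le_sum_of_subset_of_nonneg (subset_univ _) fun f _ _ =>
          mul_nonneg hε (edgeWeight_nonneg s f)
    _ ≤ _ := by
        rw [← mul_sum]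
        exact mul_le_mul_of_nonneg_left (sum_edgeWeight_le s hm hL) hε

/-- Pairs with at most one common edge factor; the others are counted by `overlap`. -/
lemma sum_nbr_erase_le (hc : 1 ≤ c) (s : A → Finset E) (h2 : ∀ α, 2 ≤ #(s α)) (H : Finset E) :
    ∑ α, ∑ β ∈ (nbr s H α).erase α, 𝔼 χ, monoInd (c := c) (s α) χ * monoInd (s β) χ
      ≤ overlap c s + ∑ α, ∑ β ∈ nbr s H α, monoProb c (s α) * monoProb c (s β) := by
  rw [overlap, ← sum_add_distrib]
  refine sum_le_sum fun α _ => ?_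
  have hne : ∀ α, (s α).Nonempty := fun α => card_pos.1 (by have := h2 α; omega)
  rw [← sum_filter_add_sum_filter_not _ (fun β => 2 ≤ #(s α ∩ s β))]
  refine add_le_add (sum_le_sum_of_subset_of_nonneg (fun β hβ => ?_)
    fun β _ _ => expect_mul_nonneg _ _) ?_
  · have := mem_filter.1 hβ
    exact mem_filter.2 ⟨mem_univ _, ne_of_mem_erase this.1, this.2⟩
  · refine le_trans (sum_le_sum fun β hβ => le_of_eq (expect_mul_of_inter_le_one hc (hne α) (hne β)
      (by have := (mem_filter.1 hβ).2; omega))) (sum_le_sum_of_subset_of_nonneg (fun β hβ => ?_)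
      fun β _ _ => mul_nonneg (monoProb_nonneg _) (monoProb_nonneg _))
    exact mem_of_mem_erase (mem_filter.1 hβ).1

/-- Any two members containing `h` and `h'` share two edges. In the expanded square, the
off-diagonal terms are therefore bounded by `overlap`, and the diagonal by p² ≤ p/c. -/
lemma sq_sum_monoProb_pair_le (hc : 1 ≤ c) (s : A → Finset E) (h2 : ∀ α, 2 ≤ #(s α)) {L : ℝ}
    (hL : ∑ α, monoProb c (s α) ≤ L) {h h' : E} (hh : h ≠ h') :
    (∑ α with h ∈ s α ∧ h' ∈ s α, monoProb c (s α)) ^ 2 ≤ overlap c s + L / c := by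
  rw [sq, sum_mul_sum]
  have hcard : ∀ α β, h ∈ s α ∧ h' ∈ s α → h ∈ s β ∧ h' ∈ s β → 2 ≤ #(s α ∩ s β) := by
    intro α β hα hβ
    rw [← card_pair hh]
    refine card_le_card fun x hx => ?_
    rcases mem_insert.1 hx with rfl | hx
    · exact mem_inter.2 ⟨hα.1, hβ.1⟩
    · rw [mem_singleton.1 hx]; exact mem_inter.2 ⟨hα.2, hβ.2⟩
  calc _ ≤ ∑ α with h ∈ s α ∧ h' ∈ s α,
        ((∑ β with β ≠ α ∧ 2 ≤ #(s α ∩ s β), 𝔼 χ, monoInd (c := c) (s α) χ * monoInd (s β) χ)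
          + monoProb c (s α) * (c : ℝ)⁻¹) := by
        refine sum_le_sum fun α hα => ?_
        rw [← add_sum_erase _ _ hα, add_comm]
        refine add_le_add ?_ (mul_le_mul_of_nonneg_left (monoProb_le_inv hc (h2 α))
          (monoProb_nonneg _))
        refine le_trans (sum_le_sum fun β hβ => ?_) (sum_le_sum_of_subset_of_nonneg
          (fun β hβ => ?_) fun β _ _ => expect_mul_nonneg _ _)
        · refine monoProb_mul_le hc (card_pos.1 ?_)
          have := hcard α β (mem_filter.1 hα).2 (mem_filter.1 (mem_of_mem_erase hβ)).2
          omega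
        · exact mem_filter.2 ⟨mem_univ _, ne_of_mem_erase hβ,
            hcard α β (mem_filter.1 hα).2 (mem_filter.1 (mem_of_mem_erase hβ)).2⟩
    _ ≤ ∑ α, ((∑ β with β ≠ α ∧ 2 ≤ #(s α ∩ s β),
          𝔼 χ, monoInd (c := c) (s α) χ * monoInd (s β) χ) + monoProb c (s α) * (c : ℝ)⁻¹) := by
        refine sum_le_sum_of_subset_of_nonneg (subset_univ _) fun α _ _ => ?_
        exact add_nonneg (sum_nonneg fun β _ => expect_mul_nonneg _ _)
          (mul_nonneg (monoProb_nonneg _) (by positivity))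
    _ ≤ _ := by
        rw [sum_add_distrib, ← sum_mul, div_eq_mul_inv, overlap]
        gcongr

lemma sum_monoProb_two_mem_le (hc : 1 ≤ c) (s : A → Finset E) (h2 : ∀ α, 2 ≤ #(s α)) {L : ℝ}
    (hL : ∑ α, monoProb c (s α) ≤ L) (H : Finset E) :
    ∑ α with 2 ≤ #(s α ∩ H), monoProb c (s α)
      ≤ (#H : ℝ) ^ 2 * Real.sqrt (overlap c s + L / c) := by
  calc _ ≤ ∑ α, ∑ x ∈ H.offDiag, if x.1 ∈ s α ∧ x.2 ∈ s α then monoProb c (s α) else 0 := by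
        rw [sum_filter]
        refine sum_le_sum fun α _ => ?_
        have hnn : ∀ x ∈ H.offDiag, 0 ≤ if x.1 ∈ s α ∧ x.2 ∈ s α then monoProb c (s α) else 0 :=
          fun x _ => by have := monoProb_nonneg (c := c) (s α); split_ifs <;> positivity
        split_ifs with h
        · obtain ⟨a, ha, b, hb, hab⟩ := one_lt_card.1 h
          have ha := mem_inter.1 ha
          have hb := mem_inter.1 hb
          have := single_le_sum hnn (mem_offDiag.2 ⟨ha.2, hb.2, hab⟩ : (a, b) ∈ H.offDiag)
          simpa [ha.1, hb.1] using this
        · exact sum_nonneg hnn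
    _ = ∑ x ∈ H.offDiag, ∑ α with x.1 ∈ s α ∧ x.2 ∈ s α, monoProb c (s α) := by
        rw [sum_comm]
        simp only [sum_filter]
    _ ≤ ∑ x ∈ H.offDiag, Real.sqrt (overlap c s + L / c) := sum_le_sum fun x hx =>
        Real.le_sqrt_of_sq_le (sq_sum_monoProb_pair_le hc s h2 hL (mem_offDiag.1 hx).2.2)
    _ ≤ _ := by
        rw [sum_const, nsmul_eq_mul]
        refine mul_le_mul_of_nonneg_right ?_ (Real.sqrt_nonneg _)
        rw [offDiag_card]
        calc ((#H * #H - #H : ℕ) : ℝ) ≤ ((#H * #H : ℕ) : ℝ) := by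
              exact_mod_cast Nat.sub_le _ _
          _ = _ := by push_cast; ring

/-- The indicator that the edges in `H` have distinct colors. -/
noncomputable def rainbow (H : Finset E) (χ : E → Fin c) : ℝ :=
  open Classical in if Set.InjOn χ H then 1 else 0

omit [Fintype E] [DecidableEq E] in
lemma rainbow_nonneg (H : Finset E) (χ : E → Fin c) : 0 ≤ rainbow H χ := by
  unfold rainbow; split_ifs <;> norm_num

omit [Fintype E] [DecidableEq E] in
lemma rainbow_le_one (H : Finset E) (χ : E → Fin c) : rainbow H χ ≤ 1 := by
  unfold rainbow; split_ifs <;> norm_num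

omit [Fintype E] in
lemma rainbow_update {H : Finset E} {f : E} (hf : f ∉ H) (χ : E → Fin c) (a : Fin c) :
    rainbow H (Function.update χ f a) = rainbow H χ := by
  have : Set.EqOn (Function.update χ f a) χ H := fun e he =>
    Function.update_of_ne (ne_of_mem_of_not_mem he hf) _ _
  unfold rainbow
  simp only [this.injOn_iff]

lemma monoInd_mul_rainbow {s H : Finset E} (h : 2 ≤ #(s ∩ H)) (χ : E → Fin c) :
    monoInd s χ * rainbow H χ = 0 := by
  obtain ⟨a, ha, b, hb, hab⟩ := one_lt_card.1 h
  have ha := mem_inter.1 ha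
  have hb := mem_inter.1 hb
  unfold monoInd rainbow
  split_ifs with h1 h2
  · exact absurd (h2 ha.2 hb.2 (h1 a ha.1 b hb.1)) hab
  all_goals simp

lemma one_sub_expect_rainbow_le (hc : 1 ≤ c) (H : Finset E) :
    1 - 𝔼 χ, rainbow (c := c) H χ ≤ (#H : ℝ) ^ 2 * (c : ℝ)⁻¹ := by
  rw [← expect_one_eq (E := E) (K := ℝ) hc, ← expect_sub_distrib]
  calc _ ≤ 𝔼 χ : E → Fin c, ∑ x ∈ H.offDiag, (if χ x.1 = χ x.2 then (1 : ℝ) else 0) := by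
        refine expect_le_expect fun χ _ => ?_
        have hnn : ∀ x ∈ H.offDiag, (0 : ℝ) ≤ if χ x.1 = χ x.2 then 1 else 0 :=
          fun x _ => by split_ifs <;> norm_num
        unfold rainbow
        split_ifs with h
        · simp only [sub_self]; exact sum_nonneg hnn
        · simp only [Set.InjOn, not_forall] at h
          obtain ⟨a, ha, b, hb, hab, hne⟩ := h
          have := single_le_sum hnn (mem_offDiag.2 ⟨ha, hb, hne⟩ : (a, b) ∈ H.offDiag)
          simpa [hab] using this
    _ = ∑ x ∈ H.offDiag, (c : ℝ)⁻¹ := by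
        rw [expect_sum_comm]
        refine sum_congr rfl fun x hx => ?_
        rw [expect_ite_eq hc (mem_offDiag.1 hx).2.2 (fun _ => (1 : ℝ)) (by simp),
          expect_one_eq hc, mul_one]
    _ ≤ _ := by
        rw [sum_const, nsmul_eq_mul]
        refine mul_le_mul_of_nonneg_right ?_ (by positivity)
        rw [offDiag_card]
        calc ((#H * #H - #H : ℕ) : ℝ) ≤ ((#H * #H : ℕ) : ℝ) := by
              exact_mod_cast Nat.sub_le _ _
          _ = _ := by push_cast; ring

/-- Poisson approximation for the characteristic function of a weighted number of monochromatic
members of a family of edge sets. -/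
lemma norm_expect_cexp_sub_le (hc : 1 ≤ c) (s : A → Finset E) (θ : A → ℝ)
    (h2 : ∀ α, 2 ≤ #(s α)) {m : ℕ} (hm : ∀ α, #(s α) ≤ m) {Θ L ε : ℝ} (hε : 0 < ε)
    (hΘ : 0 ≤ Θ) (hθ : ∀ α, |θ α| ≤ Θ) (hL : ∑ α, monoProb c (s α) ≤ L) :
    ‖𝔼 χ : E → Fin c, Complex.exp ((wsum s θ χ : ℝ) * Complex.I)
      - Complex.exp (∑ α, monoProb c (s α) * (Complex.exp (θ α * Complex.I) - 1))‖
    ≤ Real.exp (4 * L) * (Θ * (2 * overlap c s + 4 * (ε * (m * L))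
        + (m * L / ε) ^ 2 * Real.sqrt (overlap c s + L / c)))
      + (1 + Real.exp (2 * L)) * ((m * L / ε) ^ 2 * (c : ℝ)⁻¹) := by
  set H := heavy c s ε with hH
  have hcard : (#H : ℝ) ≤ m * L / ε := (le_div_iff₀ hε).2 (card_heavy_mul_le s hm hL)
  have hcard2 : (#H : ℝ) ^ 2 ≤ (m * L / ε) ^ 2 := by gcongr
  have hb₁ := sum_nbr_heavy_le s hm hε.le hL
  have hb₂ := sum_nbr_erase_le hc s h2 H
  have hb₃ := (sum_monoProb_two_mem_le hc s h2 hL H).trans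
    (mul_le_mul_of_nonneg_right hcard2 (Real.sqrt_nonneg _))
  have hρ := (one_sub_expect_rainbow_le hc H).trans
    (mul_le_mul_of_nonneg_right hcard2 (by positivity : (0 : ℝ) ≤ (c : ℝ)⁻¹))
  -- The rainbow event depends only on the colors in `H` and excludes monochromatic members with two
  -- edges there.
  have main := norm_expect_cexp_wsum_sub_le hc s θ H (rainbow H) (rainbow_nonneg H)
    (rainbow_le_one H) (fun f hf χ a => rainbow_update hf χ a)
    (fun χ α h => monoInd_mul_rainbow h χ) h2 hθ hL hb₁
    (hb₂.trans (add_le_add le_rfl hb₁)) hb₃ hΘ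
  set Q : ℂ := ∑ α, monoProb c (s α) * (Complex.exp (θ α * Complex.I) - 1) with hQ
  set ρ : ℝ := 𝔼 χ, rainbow (c := c) H χ with hρd
  have hρ1 : 0 ≤ 1 - ρ := by
    rw [sub_nonneg, ← expect_one_eq (E := E) (K := ℝ) hc]
    exact expect_le_expect fun χ _ => rainbow_le_one H χ
  have hQn : ‖Complex.exp Q‖ ≤ Real.exp (2 * L) := by
    refine (Complex.norm_exp_le_exp_norm _).trans (Real.exp_le_exp.2 ?_)
    calc _ ≤ ∑ α, monoProb c (s α) * 2 := by
          refine norm_sum_le_of_le _ fun α _ => ?_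
          rw [norm_mul, Complex.norm_real, Real.norm_of_nonneg (monoProb_nonneg _)]
          exact mul_le_mul_of_nonneg_left (norm_cexp_sub_one_le_two _) (monoProb_nonneg _)
      _ ≤ _ := by rw [← sum_mul]; linarith
  have hρc : 𝔼 χ : E → Fin c, (rainbow H χ : ℂ) = (ρ : ℂ) := by
    rw [hρd]; exact (Complex.ofReal_expect _ _).symm
  have hfirst : ‖𝔼 χ : E → Fin c, Complex.exp ((wsum s θ χ : ℝ) * Complex.I)
      - 𝔼 χ : E → Fin c, ((rainbow H χ : ℂ) * Complex.exp ((wsum s θ χ : ℝ) * Complex.I))‖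
      ≤ 1 - ρ := by
    rw [← expect_sub_distrib, hρd, ← expect_one_eq (E := E) (K := ℝ) hc, ← expect_sub_distrib]
    refine (RCLike.norm_expect_le (K := ℂ)).trans (expect_le_expect fun χ _ => ?_)
    rw [← one_sub_mul, norm_mul, Complex.norm_exp_ofReal_mul_I, mul_one, ← Complex.ofReal_one,
      ← Complex.ofReal_sub, Complex.norm_real, Real.norm_of_nonneg]
    exact sub_nonneg.2 (rainbow_le_one H χ)
  have hlast : ‖Complex.exp Q * (ρ : ℂ) - Complex.exp Q‖ ≤ Real.exp (2 * L) * (1 - ρ) := by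
    rw [← mul_sub_one, norm_mul, norm_sub_rev, ← Complex.ofReal_one,
      ← Complex.ofReal_sub, Complex.norm_real, Real.norm_of_nonneg hρ1]
    exact mul_le_mul_of_nonneg_right hQn hρ1
  rw [hρc] at main
  have htri : ‖𝔼 χ : E → Fin c, Complex.exp ((wsum s θ χ : ℝ) * Complex.I) - Complex.exp Q‖
      ≤ (1 - ρ) + Real.exp (4 * L) * (Θ * (2 * (overlap c s + ε * (m * L)) + 2 * (ε * (m * L))
        + (m * L / ε) ^ 2 * Real.sqrt (overlap c s + L / c))) + Real.exp (2 * L) * (1 - ρ) := by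
    refine le_trans ?_ (add_le_add (add_le_add hfirst main) hlast)
    refine le_trans (le_of_eq ?_) norm_add₃_le
    congr 1
    ring
  refine htri.trans ?_
  have h3 : (1 + Real.exp (2 * L)) * (1 - ρ)
      ≤ (1 + Real.exp (2 * L)) * ((m * L / ε) ^ 2 * (c : ℝ)⁻¹) :=
    mul_le_mul_of_nonneg_left hρ (by positivity)
  have h4 : 2 * (overlap c s + ε * (m * L)) + 2 * (ε * (m * L))
      = 2 * overlap c s + 4 * (ε * (m * L)) := by ring
  rw [h4]
  linarith

end HeavyEdges

/-! ### Overlaps from the variance, and cross overlaps by Cauchy–Schwarz -/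

section SecondMoment

open Finset
open scoped BigOperators

variable {E : Type*} [Fintype E] [DecidableEq E] {c : ℕ}
variable {A : Type*} [Fintype A] [DecidableEq A]
variable {B : Type*} [Fintype B] [DecidableEq B]

lemma monoInd_mul_self (s : Finset E) (χ : E → Fin c) :
    monoInd s χ * monoInd s χ = monoInd s χ := by
  unfold monoInd; split_ifs <;> simp

/-- If the variance of the number of monochromatic members is close to its mean, then the
overlaps are negligible. -/
lemma overlap_le_of_variance (hc : 2 ≤ c) (s : A → Finset E) (h2 : ∀ α, 2 ≤ #(s α)) :
    overlap c s ≤ 2 * ((𝔼 χ : E → Fin c, (∑ α, monoInd (s α) χ) ^ 2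
      - (𝔼 χ : E → Fin c, ∑ α, monoInd (s α) χ) ^ 2)
      - (𝔼 χ : E → Fin c, ∑ α, monoInd (s α) χ)
      + (𝔼 χ : E → Fin c, ∑ α, monoInd (s α) χ) * (c : ℝ)⁻¹) := by
  have hc1 : 1 ≤ c := by omega
  have hx : (c : ℝ)⁻¹ ≤ 1 / 2 := by
    rw [one_div]; exact inv_anti₀ (by norm_num) (by exact_mod_cast hc)
  have hne : ∀ α, (s α).Nonempty := fun α => card_pos.1 (by have := h2 α; omega)
  have hM : 𝔼 χ : E → Fin c, ∑ α, monoInd (s α) χ = ∑ α, monoProb c (s α) := by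
    rw [expect_sum_comm]
    exact sum_congr rfl fun α _ => expect_monoInd hc1 (hne α)
  have hS : 𝔼 χ : E → Fin c, (∑ α, monoInd (s α) χ) ^ 2
      = ∑ α, ∑ β, 𝔼 χ, monoInd (c := c) (s α) χ * monoInd (s β) χ := by
    simp only [sq, sum_mul_sum, expect_sum_comm]
  rw [hM, hS]
  -- Row `α` of the covariance matrix: p − p² ≥ p − p/c on the diagonal, 0 for at most one common
  -- edge. For two or more, the product of probabilities is at most 1/c ≤ 1/2 of the joint
  -- probability, whence the factor 2 in the statement.
  have key : ∀ α, monoProb c (s α) - monoProb c (s α) * (c : ℝ)⁻¹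
      + (∑ β with β ≠ α ∧ 2 ≤ #(s α ∩ s β),
        𝔼 χ, monoInd (c := c) (s α) χ * monoInd (s β) χ) / 2
      ≤ ∑ β, (𝔼 χ, monoInd (c := c) (s α) χ * monoInd (s β) χ
        - monoProb c (s α) * monoProb c (s β)) := by
    intro α
    rw [← add_sum_erase _ _ (mem_univ α)]
    refine add_le_add ?_ ?_
    · simp only [monoInd_mul_self]
      rw [expect_monoInd hc1 (hne α)]
      have := mul_le_mul_of_nonneg_left (monoProb_le_inv hc1 (h2 α))
        (monoProb_nonneg (c := c) (s α))
      linarith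
    · rw [sum_div, sum_filter]
      rw [← add_sum_erase _ _ (mem_univ α)]
      simp only [ne_eq, not_true_eq_false, false_and, if_false, zero_add]
      refine sum_le_sum fun β hβ => ?_
      split_ifs with h
      · have hinter : (s α ∩ s β).Nonempty := card_pos.1 (by omega)
        rw [expect_mul_of_inter hc1 hinter]
        have : monoProb c (s α) * monoProb c (s β)
            ≤ ((c : ℝ)⁻¹) ^ (#(s α ∪ s β) - 1) * (c : ℝ)⁻¹ := by
          unfold monoProb
          rw [← pow_add, ← pow_succ]
          apply pow_le_pow_of_le_one (by positivity) (by linarith)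
          have h1 := card_union_add_card_inter (s α) (s β)
          have h3 := card_le_card (inter_subset_left : s α ∩ s β ⊆ s α)
          have h4 := card_le_card (inter_subset_right : s α ∩ s β ⊆ s β)
          have := h.2
          omega
        have h5 : ((c : ℝ)⁻¹) ^ (#(s α ∪ s β) - 1) * (c : ℝ)⁻¹
            ≤ ((c : ℝ)⁻¹) ^ (#(s α ∪ s β) - 1) * (1 / 2) :=
          mul_le_mul_of_nonneg_left hx (by positivity)
        linarith
      · have h' : #(s α ∩ s β) ≤ 1 := by
          by_contra hlt
          exact h ⟨ne_of_mem_erase hβ, by omega⟩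
        rw [expect_mul_of_inter_le_one hc1 (hne α) (hne β) h', sub_self]
  have := sum_le_sum fun α (_ : α ∈ univ) => key α
  simp only [sum_add_distrib, sum_sub_distrib, ← sum_mul, ← sum_div] at this
  rw [overlap, sq, sum_mul_sum]
  linarith

/-- In this form the interaction of `s` and `t` is a weight of the intersection alone, as
Cauchy–Schwarz requires. -/
lemma expect_mul_eq_pow (hc : 1 ≤ c) {s t : Finset E} (h : (s ∩ t).Nonempty) :
    𝔼 χ, monoInd (c := c) s χ * monoInd t χ
      = (c : ℝ) ^ (1 + #(s ∩ t)) * ((c : ℝ)⁻¹) ^ (#s + #t) := by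
  rw [expect_mul_of_inter hc h]
  have hc' : (c : ℝ) ≠ 0 := by exact_mod_cast (by omega : c ≠ 0)
  have h1 := card_union_add_card_inter s t
  have h3 := card_le_card (inter_subset_left : s ∩ t ⊆ s)
  have h4 := card_le_card (inter_subset_right : s ∩ t ⊆ t)
  have h5 := h.card_pos
  rw [show #s + #t = (1 + #(s ∩ t)) + (#(s ∪ t) - 1) by omega, pow_add ((c : ℝ)⁻¹) (1 + _),
    ← mul_assoc, ← mul_pow, mul_inv_cancel₀ hc', one_pow, one_mul]

/-- The sum over the members of the family that contain `K` of `c ^ (-a)`. -/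
noncomputable def codegree (c a : ℕ) (s : A → Finset E) (K : Finset E) : ℝ :=
  ∑ α with K ⊆ s α, ((c : ℝ)⁻¹) ^ a

/-- The squares expand into pairs of members with a common subset K, at most 2^a choices each.
Distinct members share at least |K| ≥ 2 edges and fall under `overlap`; the diagonal is where `δ`
enters. -/
lemma sum_codegree_sq_le (hc : 1 ≤ c) (s : A → Finset E) {a : ℕ} (ha : ∀ α, #(s α) = a)
    (ha2 : 2 ≤ a) (𝒦 : Finset (Finset E)) (h𝒦 : ∀ K ∈ 𝒦, 2 ≤ #K) {δ : ℝ}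
    (hδ : ∀ K ∈ 𝒦, #K ≤ a → (c : ℝ) ^ #K * ((c : ℝ)⁻¹) ^ a ≤ δ) (hδ0 : 0 ≤ δ) :
    ∑ K ∈ 𝒦, (c : ℝ) ^ (1 + #K) * codegree c a s K ^ 2
      ≤ 2 ^ a * (overlap c s + δ * ∑ α, monoProb c (s α)) := by
  have hc' : (c : ℝ) ≠ 0 := by exact_mod_cast (by omega : c ≠ 0)
  have hc1 : (1 : ℝ) ≤ c := by exact_mod_cast hc
  set x : ℝ := (c : ℝ)⁻¹ with hx
  have hx0 : 0 ≤ x := by positivity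
  have hcount : ∀ (S : Finset E) (M : ℝ), 0 ≤ M → #S ≤ a →
      (∀ K ∈ 𝒦, K ⊆ S → (c : ℝ) ^ (1 + #K) * (x ^ a * x ^ a) ≤ M) →
      ∑ K ∈ 𝒦, (if K ⊆ S then (c : ℝ) ^ (1 + #K) * (x ^ a * x ^ a) else 0) ≤ 2 ^ a * M := by
    intro S M hM hS hK
    rw [← sum_filter]
    calc _ ≤ ∑ K ∈ 𝒦 with K ⊆ S, M := sum_le_sum fun K hK' =>
          hK K (mem_filter.1 hK').1 (mem_filter.1 hK').2
      _ = #(𝒦.filter (· ⊆ S)) * M := by simp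
      _ ≤ 2 ^ a * M := by
          refine mul_le_mul_of_nonneg_right ?_ hM
          have h1 : #(𝒦.filter (· ⊆ S)) ≤ #S.powerset :=
            card_le_card fun K hK => mem_powerset.2 (mem_filter.1 hK).2
          rw [card_powerset] at h1
          have h2 : 2 ^ #S ≤ 2 ^ a := Nat.pow_le_pow_right (by norm_num) hS
          exact_mod_cast h1.trans h2
  have hexp : ∑ K ∈ 𝒦, (c : ℝ) ^ (1 + #K) * codegree c a s K ^ 2
      = ∑ α, ∑ β, ∑ K ∈ 𝒦,
        (if K ⊆ s α ∩ s β then (c : ℝ) ^ (1 + #K) * (x ^ a * x ^ a) else 0) := by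
    symm
    rw [sum_congr rfl fun α _ => sum_comm, sum_comm]
    refine sum_congr rfl fun K _ => ?_
    rw [codegree, sq, sum_filter, sum_mul_sum, mul_sum]
    refine sum_congr rfl fun α _ => ?_
    rw [mul_sum]
    refine sum_congr rfl fun β _ => ?_
    simp only [subset_inter_iff]
    by_cases h1 : K ⊆ s α <;> by_cases h2 : K ⊆ s β <;> simp [h1, h2, hx]
  rw [hexp, overlap, mul_sum, ← sum_add_distrib, mul_sum]
  refine sum_le_sum fun α _ => ?_
  rw [← add_sum_erase _ _ (mem_univ α), add_comm, mul_add]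
  refine add_le_add ?_ ?_
  · rw [mul_sum, sum_filter]
    rw [← add_sum_erase univ (fun β => if β ≠ α ∧ 2 ≤ #(s α ∩ s β) then _ else _) (mem_univ α)]
    simp only [ne_eq, not_true_eq_false, false_and, if_false, zero_add]
    refine sum_le_sum fun β hβ => ?_
    have hSa : #(s α ∩ s β) ≤ a := (card_le_card inter_subset_left).trans (ha α).le
    split_ifs with h
    · refine hcount _ _ (expect_mul_nonneg _ _) hSa fun K _ hKS => ?_
      rw [expect_mul_eq_pow hc (card_pos.1 (by omega)), ha, ha, pow_add x]
      refine mul_le_mul_of_nonneg_right ?_ (by positivity)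
      exact pow_le_pow_right₀ hc1 (by have := card_le_card hKS; omega)
    · have := hcount (s α ∩ s β) 0 le_rfl hSa fun K hK hKS => by
        exfalso
        have h1 := card_le_card hKS
        have h2 := h𝒦 K hK
        exact h ⟨ne_of_mem_erase hβ, by omega⟩
      simpa using this
  · rw [inter_self]
    refine hcount _ _ (mul_nonneg hδ0 (monoProb_nonneg _)) (ha α).le fun K hK hKS => ?_
    have h1 : (c : ℝ) ^ #K * x ^ a ≤ δ := hδ K hK ((card_le_card hKS).trans (ha α).le)
    have h2 : (c : ℝ) * x ^ a = monoProb c (s α) := by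
      rw [monoProb, ha, ← hx]
      conv_lhs => rw [show a = (a - 1) + 1 by omega, pow_succ]
      rw [hx]
      field_simp
    calc _ = ((c : ℝ) ^ #K * x ^ a) * ((c : ℝ) * x ^ a) := by ring
      _ ≤ δ * monoProb c (s α) := by
          rw [h2]; exact mul_le_mul_of_nonneg_right h1 (monoProb_nonneg _)

/-- The pairs from two families that share at least two edges, but not all edges of the member of
the first family, are controlled by the overlaps within the families. -/
lemma sq_cross_le (hc : 1 ≤ c) (s : A → Finset E) (t : B → Finset E) {a b : ℕ}
    (ha : ∀ α, #(s α) = a) (hb : ∀ β, #(t β) = b) (ha2 : 2 ≤ a) (hb2 : 2 ≤ b) :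
    (∑ α, ∑ β with 2 ≤ #(s α ∩ t β) ∧ #(s α ∩ t β) < a,
      𝔼 χ, monoInd (c := c) (s α) χ * monoInd (t β) χ) ^ 2
    ≤ (2 ^ a * (overlap c s + (c : ℝ)⁻¹ * ∑ α, monoProb c (s α)))
      * (2 ^ b * (overlap c t + 1 * ∑ β, monoProb c (t β))) := by
  have hc' : (c : ℝ) ≠ 0 := by exact_mod_cast (by omega : c ≠ 0)
  have hc1 : (1 : ℝ) ≤ c := by exact_mod_cast hc
  -- Since |K| < a, the diagonal of `s` gains a factor 1/c. K may be a whole member of `t`, so there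
  -- only δ = 1 is available; one small factor is enough.
  set 𝒦 : Finset (Finset E) := univ.filter fun K => 2 ≤ #K ∧ #K < a with h𝒦
  have hpow : ∀ k l : ℕ, ((c : ℝ) ^ k * ((c : ℝ)⁻¹) ^ (k + l))
      = ((c : ℝ)⁻¹) ^ l := by
    intro k l
    rw [pow_add, ← mul_assoc, ← mul_pow, mul_inv_cancel₀ hc', one_pow, one_mul]
  have hx1 : (c : ℝ)⁻¹ ≤ 1 := inv_le_one_of_one_le₀ hc1
  have hA := sum_codegree_sq_le hc s ha ha2 𝒦 (fun K hK => (mem_filter.1 hK).2.1)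
    (δ := (c : ℝ)⁻¹) (fun K hK _ => by
      have := (mem_filter.1 hK).2.2
      obtain ⟨l, rfl⟩ : ∃ l, a = #K + l := ⟨a - #K, by omega⟩
      rw [hpow]
      calc ((c : ℝ)⁻¹) ^ l ≤ ((c : ℝ)⁻¹) ^ 1 :=
            pow_le_pow_of_le_one (by positivity) hx1 (by omega)
        _ = _ := pow_one _) (by positivity)
  have hB := sum_codegree_sq_le hc t hb hb2 𝒦 (fun K hK => (mem_filter.1 hK).2.1)
    (δ := 1) (fun K hK hKb => by
      obtain ⟨l, rfl⟩ : ∃ l, b = #K + l := ⟨b - #K, by omega⟩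
      rw [hpow]
      exact pow_le_one₀ (by positivity) hx1) zero_le_one
  have hX : ∑ α, ∑ β with 2 ≤ #(s α ∩ t β) ∧ #(s α ∩ t β) < a,
      𝔼 χ, monoInd (c := c) (s α) χ * monoInd (t β) χ
      ≤ ∑ K ∈ 𝒦, (c : ℝ) ^ (1 + #K) * (codegree c a s K * codegree c b t K) := by
    have hexp : ∑ K ∈ 𝒦, (c : ℝ) ^ (1 + #K) * (codegree c a s K * codegree c b t K)
        = ∑ α, ∑ β, ∑ K ∈ 𝒦, (if K ⊆ s α ∩ t β then
          (c : ℝ) ^ (1 + #K) * (((c : ℝ)⁻¹) ^ a * ((c : ℝ)⁻¹) ^ b) else 0) := by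
      symm
      rw [sum_congr rfl fun α _ => sum_comm, sum_comm]
      refine sum_congr rfl fun K _ => ?_
      rw [codegree, codegree, sum_filter, sum_filter, sum_mul_sum, mul_sum]
      refine sum_congr rfl fun α _ => ?_
      rw [mul_sum]
      refine sum_congr rfl fun β _ => ?_
      simp only [subset_inter_iff]
      by_cases h1 : K ⊆ s α <;> by_cases h2 : K ⊆ t β <;> simp [h1, h2]
    rw [hexp]
    refine sum_le_sum fun α _ => ?_
    rw [sum_filter]
    refine sum_le_sum fun β _ => ?_
    have hnn : ∀ K ∈ 𝒦, (0 : ℝ) ≤ if K ⊆ s α ∩ t β then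
        (c : ℝ) ^ (1 + #K) * (((c : ℝ)⁻¹) ^ a * ((c : ℝ)⁻¹) ^ b) else 0 := fun K _ => by
      split_ifs <;> positivity
    split_ifs with h
    · have := single_le_sum hnn
        (mem_filter.2 ⟨mem_univ _, h⟩ : s α ∩ t β ∈ 𝒦)
      rw [if_pos (Subset.refl _)] at this
      rw [expect_mul_eq_pow hc (card_pos.1 (by omega)), ha, hb, pow_add ((c : ℝ)⁻¹)]
      exact this
    · exact sum_nonneg hnn
  have hX0 : 0 ≤ ∑ α, ∑ β with 2 ≤ #(s α ∩ t β) ∧ #(s α ∩ t β) < a,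
      𝔼 χ, monoInd (c := c) (s α) χ * monoInd (t β) χ :=
    sum_nonneg fun α _ => sum_nonneg fun β _ => expect_mul_nonneg _ _
  calc _ ≤ (∑ K ∈ 𝒦, (c : ℝ) ^ (1 + #K) * (codegree c a s K * codegree c b t K)) ^ 2 :=
        pow_le_pow_left₀ hX0 hX 2
    _ ≤ (∑ K ∈ 𝒦, (c : ℝ) ^ (1 + #K) * codegree c a s K ^ 2)
        * (∑ K ∈ 𝒦, (c : ℝ) ^ (1 + #K) * codegree c b t K ^ 2) := by
        refine sum_sq_le_sum_mul_sum_of_sq_le_mul _ (fun K _ => by positivity)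
          (fun K _ => by positivity) (fun K _ => le_of_eq (by ring))
    _ ≤ _ := mul_le_mul hA hB (sum_nonneg fun K _ => by positivity)
        ((sum_nonneg fun K _ => by positivity).trans hA)

/-- The expected number of pairs of monochromatic members of two families that have the same
edges. -/
noncomputable def coincidence (c : ℕ) (s : A → Finset E) (t : B → Finset E) : ℝ :=
  ∑ α, ∑ β with s α = t β, monoProb c (s α)

/-- Pairs from two families that share at least two edges. -/
lemma cross_le (hc : 1 ≤ c) (s : A → Finset E) (t : B → Finset E) {a b : ℕ}
    (ha : ∀ α, #(s α) = a) (hb : ∀ β, #(t β) = b) (ha2 : 2 ≤ a) (hb2 : 2 ≤ b) :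
    ∑ α, ∑ β with 2 ≤ #(s α ∩ t β), 𝔼 χ, monoInd (c := c) (s α) χ * monoInd (t β) χ
    ≤ Real.sqrt ((2 ^ a * (overlap c s + (c : ℝ)⁻¹ * ∑ α, monoProb c (s α)))
        * (2 ^ b * (overlap c t + 1 * ∑ β, monoProb c (t β))))
      + Real.sqrt ((2 ^ b * (overlap c t + (c : ℝ)⁻¹ * ∑ β, monoProb c (t β)))
        * (2 ^ a * (overlap c s + 1 * ∑ α, monoProb c (s α)))) + coincidence c s t := by
  have h1 := Real.le_sqrt_of_sq_le (sq_cross_le hc s t ha hb ha2 hb2)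
  have h2 := Real.le_sqrt_of_sq_le (sq_cross_le hc t s hb ha hb2 ha2)
  rw [sum_congr rfl fun β _ => sum_filter _ _, sum_comm] at h2
  refine le_trans ?_ (add_le_add (add_le_add h1 h2) le_rfl)
  rw [coincidence, ← sum_add_distrib, ← sum_add_distrib]
  refine sum_le_sum fun α _ => ?_
  rw [sum_filter, sum_filter, sum_filter, ← sum_add_distrib, ← sum_add_distrib]
  refine sum_le_sum fun β _ => ?_
  have hE := expect_mul_nonneg (c := c) (s α) (t β)
  have hE' := expect_mul_nonneg (c := c) (t β) (s α)
  have hp := monoProb_nonneg (c := c) (s α)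
  by_cases h : 2 ≤ #(s α ∩ t β)
  -- The common part misses an edge of `s α`, or one of `t β`, or the two sets coincide.
  · by_cases hlt : #(s α ∩ t β) < a
    · rw [if_pos h, if_pos ⟨h, hlt⟩]
      have : ∀ x y : ℝ, 0 ≤ x → 0 ≤ y → ∀ z : ℝ, z ≤ z + x + y := fun x y hx hy z => by linarith
      apply this <;> split_ifs <;> first | assumption | exact le_rfl
    · by_cases hlt' : #(s α ∩ t β) < b
      · rw [if_pos h, if_neg (fun h => hlt h.2), if_pos (by rw [inter_comm]; exact ⟨h, hlt'⟩)]
        simp only [mul_comm (monoInd (t β) _)]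
        split_ifs <;> linarith
      · have e1 : s α ∩ t β = s α := eq_of_subset_of_card_le inter_subset_left (by
          rw [ha]; omega)
        have e2 : s α ∩ t β = t β := eq_of_subset_of_card_le inter_subset_right (by
          rw [hb]; omega)
        have e3 : s α = t β := e1.symm.trans e2
        have hs : (s α).Nonempty := card_pos.1 (by rw [ha]; omega)
        have : 𝔼 χ, monoInd (c := c) (s α) χ * monoInd (t β) χ = monoProb c (s α) := by
          simp only [← e3, monoInd_mul_self]
          exact expect_monoInd hc hs
        rw [if_pos h, if_neg (fun h => hlt h.2), if_neg (by rw [inter_comm]; exact fun h => hlt' h.2),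
          if_pos e3, this]
        linarith
  · rw [if_neg h]
    refine add_nonneg (add_nonneg ?_ ?_) ?_ <;> split_ifs <;> first | assumption | exact le_rfl

end SecondMoment

/-! ### Members of two families with the same edge set -/

section Coincidence

open Finset
open scoped BigOperators

variable {E : Type*} [Fintype E] [DecidableEq E] {c : ℕ}
variable {A : Type*} [Fintype A] [DecidableEq A]
variable {B : Type*} [Fintype B] [DecidableEq B]

omit [Fintype E] [DecidableEq A] [DecidableEq B] in
lemma coincidence_comm (s : A → Finset E) (t : B → Finset E) :
    coincidence c s t = coincidence c t s := by
  simp only [coincidence, sum_filter]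
  rw [sum_comm]
  refine sum_congr rfl fun β _ => sum_congr rfl fun α _ => ?_
  by_cases h : s α = t β
  · rw [if_pos h, if_pos h.symm, h]
  · rw [if_neg h, if_neg (Ne.symm h)]

omit [DecidableEq A] [DecidableEq B] in
lemma coincidence_eq_sum_fiber (s : A → Finset E) (t : B → Finset E) :
    coincidence c s t = ∑ K, (#{α | s α = K} : ℝ) * (#{β | t β = K} * monoProb c K) := by
  have h1 : coincidence c s t = ∑ α, (#{β | t β = s α} * monoProb c (s α)) :=
    sum_congr rfl fun α _ => by
      rw [sum_const, nsmul_eq_mul]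
      simp only [eq_comm]
  rw [h1, ← sum_fiberwise' univ s fun K => (#{β | t β = K} : ℝ) * monoProb c K]
  simp

/-- A fiber of size x contains x(x − 1) ordered pairs of distinct members, which share all their
edges. -/
lemma sum_fiber_le_overlap (hc : 1 ≤ c) (s : A → Finset E) (h2 : ∀ α, 2 ≤ #(s α)) :
    ∑ K, (#{α | s α = K} : ℝ) * ((#{α | s α = K} - 1) * monoProb c K) ≤ overlap c s := by
  have h1 : ∑ K, (#{α | s α = K} : ℝ) * ((#{α | s α = K} - 1) * monoProb c K)
      = ∑ α, ((#{β | s β = s α} - 1) * monoProb c (s α)) := by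
    rw [← sum_fiberwise' univ s fun K => ((#{α | s α = K} : ℝ) - 1) * monoProb c K]
    simp
  rw [h1, overlap]
  refine sum_le_sum fun α _ => ?_
  have hne : (s α).Nonempty := card_pos.1 (by have := h2 α; omega)
  have h3 : (#{β | s β = s α} : ℝ) - 1 = #((univ.filter fun β => s β = s α).erase α) := by
    rw [card_erase_of_mem (by simp), Nat.cast_sub, Nat.cast_one]
    exact card_pos.2 ⟨α, by simp⟩
  calc _ = ∑ β ∈ (univ.filter fun β => s β = s α).erase α,
        𝔼 χ, monoInd (c := c) (s α) χ * monoInd (s β) χ := by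
        rw [h3, ← nsmul_eq_mul, ← sum_const]
        refine sum_congr rfl fun β hβ => ?_
        rw [(mem_filter.1 (mem_of_mem_erase hβ)).2]
        simp only [monoInd_mul_self]
        exact (expect_monoInd hc hne).symm
    _ ≤ _ := by
        refine sum_le_sum_of_subset_of_nonneg (fun β hβ => ?_) fun β _ _ => expect_mul_nonneg _ _
        refine mem_filter.2 ⟨mem_univ _, ne_of_mem_erase hβ, ?_⟩
        rw [(mem_filter.1 (mem_of_mem_erase hβ)).2, inter_self]
        exact h2 α

/-- If a member of `t` which has the same edges as a member of `s` always has a twin in `t`, then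
coincidences are controlled by overlaps. -/
lemma coincidence_le_overlap (hc : 1 ≤ c) (s : A → Finset E) (t : B → Finset E)
    (hs2 : ∀ α, 2 ≤ #(s α)) (ht2 : ∀ β, 2 ≤ #(t β))
    (h : ∀ α β, s α = t β → ∃ β', β' ≠ β ∧ t β' = t β) :
    coincidence c s t ≤ overlap c s + overlap c t := by
  rw [coincidence_eq_sum_fiber]
  refine le_trans ?_ (add_le_add (sum_fiber_le_overlap hc s hs2) (sum_fiber_le_overlap hc t ht2))
  rw [← sum_add_distrib]
  refine sum_le_sum fun K _ => ?_
  have hp := monoProb_nonneg (c := c) K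
  set x := #{α | s α = K} with hx
  set y := #{β | t β = K} with hy
  -- This fails only for x = y = 1, which the twin hypothesis excludes.
  suffices hxy : (x : ℝ) * y ≤ x * (x - 1) + y * (y - 1) by
    have := mul_le_mul_of_nonneg_right hxy hp
    linarith
  rcases Nat.eq_zero_or_pos x with h0 | hxpos
  · rcases Nat.eq_zero_or_pos y with h0' | hypos
    · simp [h0, h0']
    · have : (1 : ℝ) ≤ y := by exact_mod_cast hypos
      rw [h0]
      push_cast
      nlinarith
  rcases Nat.eq_zero_or_pos y with h0' | hypos
  · have : (1 : ℝ) ≤ x := by exact_mod_cast hxpos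
    rw [h0']
    push_cast
    nlinarith
  obtain ⟨α, hα⟩ := card_pos.1 hxpos
  obtain ⟨β, hβ⟩ := card_pos.1 hypos
  have hα := (mem_filter.1 hα).2
  have hβ' := (mem_filter.1 hβ).2
  obtain ⟨β', hne, hβt⟩ := h α β (hα.trans hβ'.symm)
  have hy2 : 2 ≤ y := one_lt_card.2
    ⟨β', mem_filter.2 ⟨mem_univ _, hβt.trans hβ'⟩, β, hβ, hne⟩
  have hy2' : (2 : ℝ) ≤ y := by exact_mod_cast hy2
  have hx1 : (1 : ℝ) ≤ x := by exact_mod_cast hxpos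
  rcases Nat.eq_or_lt_of_le hxpos with h1 | h1
  · rw [← h1]
    push_cast
    nlinarith
  · have hx2 : (2 : ℝ) ≤ x := by exact_mod_cast h1
    nlinarith [sq_nonneg ((x : ℝ) - y)]

omit [Fintype E] [DecidableEq A] [DecidableEq B] in
lemma coincidence_le_card (hc : 1 ≤ c) (s : A → Finset E) (t : B → Finset E)
    (hs2 : ∀ α, 2 ≤ #(s α)) :
    coincidence c s t ≤ Fintype.card A * Fintype.card B * (c : ℝ)⁻¹ := by
  calc coincidence c s t ≤ ∑ _α : A, ∑ _β : B, (c : ℝ)⁻¹ := by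
        refine sum_le_sum fun α _ => ?_
        exact (sum_le_sum fun β _ => monoProb_le_inv hc (hs2 α)).trans
          (sum_le_sum_of_subset_of_nonneg (subset_univ _) fun _ _ _ => by positivity)
    _ = _ := by simp [mul_assoc]

end Coincidence

/-! ### Copies of graphs, isolated vertices and twins -/

section Graphs

open SimpleGraph

variable {V W W' : Type*}

/-- The copies of `F` in `G`. -/
def Copies (F : SimpleGraph W) (G : SimpleGraph V) : Type _ :=
  {H : G.Subgraph // Nonempty (F ≃g H.coe)}

instance (F : SimpleGraph W) (G : SimpleGraph V) [Finite V] : Finite (Copies F G) :=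
  inferInstanceAs (Finite {H : G.Subgraph // Nonempty (F ≃g H.coe)})

noncomputable instance (F : SimpleGraph W) (G : SimpleGraph V) [Finite V] :
    Fintype (Copies F G) := Fintype.ofFinite _

/-- The edges of a subgraph of `G`, as a finite set of edges of `G`. -/
noncomputable def edgeFin {G : SimpleGraph V} [Fintype G.edgeSet] (H : G.Subgraph) :
    Finset G.edgeSet :=
  open Classical in Finset.univ.filter fun e => (e : Sym2 V) ∈ H.edgeSet

lemma mem_edgeFin {G : SimpleGraph V} [Fintype G.edgeSet] {H : G.Subgraph} {e : G.edgeSet} :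
    e ∈ edgeFin H ↔ (e : Sym2 V) ∈ H.edgeSet := by
  simp [edgeFin]

lemma edgeFin_inj_edgeSet {G : SimpleGraph V} [Fintype G.edgeSet] {H H' : G.Subgraph} :
    edgeFin H = edgeFin H' ↔ H.edgeSet = H'.edgeSet := by
  constructor
  · intro h
    ext e
    constructor
    · intro he
      have : (⟨e, H.edgeSet_subset he⟩ : G.edgeSet) ∈ edgeFin H := mem_edgeFin.2 he
      rw [h] at this
      exact mem_edgeFin.1 this
    · intro he
      have : (⟨e, H'.edgeSet_subset he⟩ : G.edgeSet) ∈ edgeFin H' := mem_edgeFin.2 he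
      rw [← h] at this
      exact mem_edgeFin.1 this
  · intro h
    ext e
    rw [mem_edgeFin, mem_edgeFin, h]

lemma card_edgeFin {F : SimpleGraph W} {G : SimpleGraph V} [Fintype G.edgeSet] (H : Copies F G) :
    (edgeFin H.1).card = Nat.card F.edgeSet := by
  obtain ⟨H, ⟨φ⟩⟩ := H
  rw [Nat.card_congr φ.mapEdgeSet, Nat.card_coe_set_eq,
    ← Set.ncard_image_of_injective _ (Sym2.map.injective Subtype.val_injective),
    Subgraph.image_coe_edgeSet_coe]
  rw [← Set.ncard_coe_finset, ← Set.ncard_image_of_injective _ Subtype.val_injective]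
  congr 1
  ext e
  simp only [Set.mem_image, Finset.mem_coe, mem_edgeFin, Subtype.exists, exists_and_left,
    exists_prop, exists_eq_right_right]
  exact ⟨fun h => h.1, fun h => ⟨h, H.edgeSet_subset h⟩⟩

lemma ncard_verts_eq {F : SimpleGraph W} {G : SimpleGraph V} {H : G.Subgraph}
    (h : Nonempty (F ≃g H.coe)) : H.verts.ncard = Nat.card W := by
  obtain ⟨φ⟩ := h
  rw [Nat.card_congr φ.toEquiv, Nat.card_coe_set_eq]

lemma adj_iff_of_edgeSet_eq {G : SimpleGraph V} {H H' : G.Subgraph} (h : H.edgeSet = H'.edgeSet)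
    (a b : V) : H.Adj a b ↔ H'.Adj a b := by
  rw [← Subgraph.mem_edgeSet, h, Subgraph.mem_edgeSet]

/-- Subgraphs with the same edges and the same number of vertices are isomorphic. -/
lemma nonempty_iso_of_edgeSet_eq [Finite V] {G : SimpleGraph V} {H H' : G.Subgraph}
    (h : H.edgeSet = H'.edgeSet) (hv : H.verts.ncard = H'.verts.ncard) :
    Nonempty (H.coe ≃g H'.coe) := by
  classical
  have := Fintype.ofFinite V
  have hadj := adj_iff_of_edgeSet_eq h
  -- The identity on the non-isolated vertices extends to a bijection of the vertex sets, matching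
  -- isolated vertices arbitrarily.
  obtain ⟨g, hg⟩ := Finset.exists_equiv_extend_of_card_eq (α := H.verts) (β := V)
    (t := H'.verts.toFinset) (by rw [← Set.ncard_eq_toFinset_card', ← hv, ← Nat.card_coe_set_eq,
      Nat.card_eq_fintype_card])
    (s := Finset.univ.filter fun v : H.verts => (v : V) ∈ H.support) (f := Subtype.val)
    (by
      intro v hv
      obtain ⟨w, hw, rfl⟩ := Finset.mem_image.1 hv
      obtain ⟨u, hu⟩ := (Finset.mem_filter.1 hw).2
      exact Set.mem_toFinset.2 (H'.edge_vert ((hadj _ _).1 hu)))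
    Subtype.val_injective.injOn
  have hgmem : ∀ v, ((g v : V)) ∈ H'.verts := fun v => Set.mem_toFinset.1 (g v).2
  have hsupp : ∀ v : H.verts, ((g v : V) ∈ H.support) → (g v : V) = v := by
    intro v hv
    obtain ⟨u, hu⟩ := hv
    have h1 := hg ⟨(g v : V), H.edge_vert hu⟩ (Finset.mem_filter.2 ⟨Finset.mem_univ _, u, hu⟩)
    have h2 := g.injective (Subtype.ext h1)
    exact congrArg Subtype.val h2
  have hsupp' : ∀ v : H.verts, ((v : V) ∈ H.support) → (g v : V) = v := fun v hv =>
    hg v (Finset.mem_filter.2 ⟨Finset.mem_univ _, hv⟩)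
  refine ⟨{ toEquiv := g.trans (Equiv.subtypeEquivRight fun v => Set.mem_toFinset)
            map_rel_iff' := ?_ }⟩
  intro a b
  change H'.Adj (g a : V) (g b : V) ↔ H.Adj (a : V) (b : V)
  rw [← hadj]
  constructor
  · intro hab
    rwa [hsupp a ⟨_, hab⟩, hsupp b ⟨_, hab.symm⟩] at hab
  · intro hab
    rwa [hsupp' a ⟨_, hab⟩, hsupp' b ⟨_, hab.symm⟩]

/-- A copy of `F` with an isolated vertex that does not use all vertices of `G` has a twin: another
copy of `F` with the same edges. -/
lemma exists_twin [Finite V] {F : SimpleGraph W} {G : SimpleGraph V}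
    (T : Copies F G) {u v : V} (hu : u ∈ T.1.verts) (hus : u ∉ T.1.support)
    (hv : v ∉ T.1.verts) : ∃ T' : Copies F G, T' ≠ T ∧ T'.1.edgeSet = T.1.edgeSet := by
  obtain ⟨T, hT⟩ := T
  let T' : G.Subgraph :=
    { verts := insert v (T.verts \ {u})
      Adj := T.Adj
      adj_sub := T.adj_sub
      edge_vert := fun {a b} hab => Set.mem_insert_of_mem _ ⟨T.edge_vert hab, fun hau => by
        rw [Set.mem_singleton_iff] at hau
        exact hus ⟨b, hau ▸ hab⟩⟩
      symm := T.symm }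
  have hE : T'.edgeSet = T.edgeSet := by
    ext e
    induction e with
    | _ a b => rfl
  have hcard : T'.verts.ncard = T.verts.ncard := Set.ncard_exchange hv hu
  obtain ⟨ψ⟩ := nonempty_iso_of_edgeSet_eq hE.symm hcard.symm
  obtain ⟨φ⟩ := hT
  refine ⟨⟨T', ⟨φ.trans ψ⟩⟩, fun h => hv ?_, hE⟩
  have h1 : T' = T := congrArg Subtype.val h
  have h2 : v ∈ T'.verts := Set.mem_insert _ _
  rw [h1] at h2
  exact h2

lemma card_copies_le [Finite V] (F : SimpleGraph W) (G : SimpleGraph V) {M : ℕ}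
    (hV : Nat.card V ≤ M) : Fintype.card (Copies F G) ≤ 2 ^ (M + M * M) := by
  classical
  have := Fintype.ofFinite V
  let f : Copies F G → Set V × Set (V × V) := fun H => (H.1.verts, {x | H.1.Adj x.1 x.2})
  have hf : Function.Injective f := by
    intro H H' h
    refine Subtype.ext (Subgraph.ext (congrArg Prod.fst h) ?_)
    ext a b
    have := Set.ext_iff.1 (congrArg Prod.snd h) (a, b)
    exact this
  have h1 := Fintype.card_le_of_injective f hf
  rw [Fintype.card_prod, Fintype.card_set, Fintype.card_set, Fintype.card_prod, ← pow_add] at h1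
  rw [Nat.card_eq_fintype_card] at hV
  refine h1.trans (Nat.pow_le_pow_right (by norm_num) ?_)
  exact add_le_add hV (Nat.mul_le_mul hV hV)

/-- A copy of `F'` with the edges of a copy of `F` has a vertex outside the latter, hence an
isolated one. If `G` has more vertices than `F'`, this vertex can be moved to produce a twin;
otherwise the number of copies is bounded in terms of `F'`. -/
lemma coincidence_le_of_card_lt [Finite V] [Finite W] [Finite W'] {F : SimpleGraph W}
    {F' : SimpleGraph W'} (G : SimpleGraph V) [Fintype G.edgeSet] [DecidableEq G.edgeSet]
    [DecidableEq (Copies F G)] [DecidableEq (Copies F' G)] {c : ℕ} (hc : 1 ≤ c)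
    (h2 : 2 ≤ Nat.card F.edgeSet) (h2' : 2 ≤ Nat.card F'.edgeSet) (hW : Nat.card W < Nat.card W') :
    coincidence c (fun H : Copies F G => edgeFin H.1) (fun H : Copies F' G => edgeFin H.1)
      ≤ ((2 : ℝ) ^ (Nat.card W' + Nat.card W' * Nat.card W')) ^ 2 * (c : ℝ)⁻¹
        + (overlap c (fun H : Copies F G => edgeFin H.1)
          + overlap c (fun H : Copies F' G => edgeFin H.1)) := by
  have hs : ∀ H : Copies F G, 2 ≤ (edgeFin H.1).card := fun H => by rwa [card_edgeFin]
  have ht : ∀ H : Copies F' G, 2 ≤ (edgeFin H.1).card := fun H => by rwa [card_edgeFin]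
  have ho := overlap_nonneg (c := c) (fun H : Copies F G => edgeFin H.1)
  have ho' := overlap_nonneg (c := c) (fun H : Copies F' G => edgeFin H.1)
  by_cases hV : Nat.card V ≤ Nat.card W'
  · have h1 := coincidence_le_card hc (fun H : Copies F G => edgeFin H.1)
      (fun H : Copies F' G => edgeFin H.1) hs
    have c1 : (Fintype.card (Copies F G) : ℝ) ≤ 2 ^ (Nat.card W' + Nat.card W' * Nat.card W') := by
      exact_mod_cast card_copies_le F G hV
    have c2 : (Fintype.card (Copies F' G) : ℝ) ≤ 2 ^ (Nat.card W' + Nat.card W' * Nat.card W') := by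
      exact_mod_cast card_copies_le F' G hV
    have h3 : (Fintype.card (Copies F G) : ℝ) * Fintype.card (Copies F' G) * (c : ℝ)⁻¹
        ≤ ((2 : ℝ) ^ (Nat.card W' + Nat.card W' * Nat.card W')) ^ 2 * (c : ℝ)⁻¹ := by
      rw [sq]; gcongr
    linarith
  · push Not at hV
    have h1 := coincidence_le_overlap hc (fun H : Copies F G => edgeFin H.1)
      (fun H : Copies F' G => edgeFin H.1) hs ht (by
        intro S T hST
        have hE := edgeFin_inj_edgeSet.1 hST
        have hlt : S.1.verts.ncard < T.1.verts.ncard := by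
          rwa [ncard_verts_eq S.2, ncard_verts_eq T.2]
        obtain ⟨u, hu, huS⟩ := Set.exists_mem_notMem_of_ncard_lt_ncard hlt
        have hlt' : T.1.verts.ncard < (Set.univ : Set V).ncard := by
          rwa [ncard_verts_eq T.2, Set.ncard_univ]
        obtain ⟨v, _, hv⟩ := Set.exists_mem_notMem_of_ncard_lt_ncard hlt'
        obtain ⟨T', hne, hT'⟩ := exists_twin T hu (fun ⟨b, hb⟩ =>
          huS (S.1.edge_vert ((adj_iff_of_edgeSet_eq hE _ _).2 hb))) hv
        exact ⟨T', hne, edgeFin_inj_edgeSet.2 hT'⟩)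
    have h3 : 0 ≤ ((2 : ℝ) ^ (Nat.card W' + Nat.card W' * Nat.card W')) ^ 2 * (c : ℝ)⁻¹ := by
      positivity
    linarith

/-- Copies of non-isomorphic graphs with the same edges are negligible. -/
lemma coincidence_le [Finite V] [Finite W] [Finite W'] {F : SimpleGraph W}
    {F' : SimpleGraph W'} (hF : IsEmpty (F ≃g F')) (G : SimpleGraph V) [Fintype G.edgeSet]
    [DecidableEq G.edgeSet] [DecidableEq (Copies F G)] [DecidableEq (Copies F' G)] {c : ℕ}
    (hc : 1 ≤ c) (h2 : 2 ≤ Nat.card F.edgeSet) (h2' : 2 ≤ Nat.card F'.edgeSet) {M : ℕ}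
    (hM : Nat.card W ≤ M) (hM' : Nat.card W' ≤ M) :
    coincidence c (fun H : Copies F G => edgeFin H.1) (fun H : Copies F' G => edgeFin H.1)
      ≤ ((2 : ℝ) ^ (M + M * M)) ^ 2 * (c : ℝ)⁻¹
        + (overlap c (fun H : Copies F G => edgeFin H.1)
          + overlap c (fun H : Copies F' G => edgeFin H.1)) := by
  have hmono : ∀ k ≤ M, ((2 : ℝ) ^ (k + k * k)) ^ 2 * (c : ℝ)⁻¹
      ≤ ((2 : ℝ) ^ (M + M * M)) ^ 2 * (c : ℝ)⁻¹ := by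
    intro k hk
    have : (1 : ℝ) ≤ 2 := by norm_num
    gcongr
  have ho := overlap_nonneg (c := c) (fun H : Copies F G => edgeFin H.1)
  have ho' := overlap_nonneg (c := c) (fun H : Copies F' G => edgeFin H.1)
  rcases lt_trichotomy (Nat.card W) (Nat.card W') with h | h | h
  · have := coincidence_le_of_card_lt G hc h2 h2' h
    linarith [hmono _ hM']
  · have h0 : coincidence c (fun H : Copies F G => edgeFin H.1)
        (fun H : Copies F' G => edgeFin H.1) = 0 := by
      refine Finset.sum_eq_zero fun S _ => Finset.sum_eq_zero fun T hT => ?_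
      have hE := edgeFin_inj_edgeSet.1 (Finset.mem_filter.1 hT).2
      obtain ⟨ψ⟩ := nonempty_iso_of_edgeSet_eq hE
        (by rw [ncard_verts_eq S.2, ncard_verts_eq T.2, h])
      obtain ⟨φ⟩ := S.2
      obtain ⟨φ'⟩ := T.2
      exact (hF.false ((φ.trans ψ).trans φ'.symm)).elim
    rw [h0]
    positivity
  · rw [coincidence_comm]
    have := coincidence_le_of_card_lt G hc h2' h2 h
    linarith [hmono _ hM]

end Graphs

/-! ### Passage to the limit, and overlaps of a union of families -/

section Limit

open Finset
open scoped BigOperators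

/-- This expresses the order of limits: n → ∞ with the heaviness threshold ε fixed, then ε → 0. -/
lemma tendsto_zero_of_eventually_le {f : ℕ → ℝ} (hf : ∀ n, 0 ≤ f n) {C : ℝ} (hC : 0 ≤ C)
    (h : ∀ ε > 0, ∃ g : ℕ → ℝ, (∀ᶠ n in atTop, f n ≤ g n) ∧ Tendsto g atTop (𝓝 (C * ε))) :
    Tendsto f atTop (𝓝 0) := by
  refine tendsto_order.2 ⟨fun a ha => Eventually.of_forall fun n => ha.trans_le (hf n),
    fun δ hδ => ?_⟩
  obtain ⟨g, hfg, hg⟩ := h (δ / (C + 1)) (by positivity)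
  have hlt : C * (δ / (C + 1)) < δ := by
    rw [← mul_div_assoc, div_lt_iff₀ (by positivity)]
    nlinarith
  filter_upwards [hfg, hg.eventually (gt_mem_nhds hlt)] with n h1 h2
  exact h1.trans_lt h2

lemma tendsto_inv_natCast {c : ℕ → ℕ} (hc : Tendsto c atTop atTop) :
    Tendsto (fun n => ((c n : ℝ))⁻¹) atTop (𝓝 0) :=
  tendsto_inv_atTop_zero.comp (tendsto_natCast_atTop_atTop.comp hc)

/-- If the overlaps of families of edge sets are negligible, then the characteristic function of
the weighted number of monochromatic members is asymptotically compound Poisson. -/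
theorem tendsto_expect_cexp_sub {E A : ℕ → Type*} [∀ n, Fintype (E n)] [∀ n, DecidableEq (E n)]
    [∀ n, Fintype (A n)] [∀ n, DecidableEq (A n)] {c : ℕ → ℕ} (hc : Tendsto c atTop atTop)
    (s : ∀ n, A n → Finset (E n)) (θ : ∀ n, A n → ℝ) {Θ L : ℝ} {m : ℕ} (hΘ : 0 ≤ Θ)
    (hL0 : 0 ≤ L) (hθ : ∀ n α, |θ n α| ≤ Θ) (h2 : ∀ᶠ n in atTop, ∀ α, 2 ≤ #(s n α))
    (hm : ∀ n α, #(s n α) ≤ m) (hL : ∀ᶠ n in atTop, ∑ α, monoProb (c n) (s n α) ≤ L)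
    (hD : Tendsto (fun n => overlap (c n) (s n)) atTop (𝓝 0)) :
    Tendsto (fun n => 𝔼 χ : E n → Fin (c n), Complex.exp ((wsum (s n) (θ n) χ : ℝ) * Complex.I)
      - Complex.exp (∑ α, monoProb (c n) (s n α) * (Complex.exp (θ n α * Complex.I) - 1)))
      atTop (𝓝 0) := by
  rw [tendsto_zero_iff_norm_tendsto_zero]
  have hcinv := tendsto_inv_natCast hc
  refine tendsto_zero_of_eventually_le (fun n => norm_nonneg _)
    (C := Real.exp (4 * L) * (Θ * (4 * (m * L)))) (by positivity) fun ε hε => ?_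
  refine ⟨fun n => Real.exp (4 * L) * (Θ * (2 * overlap (c n) (s n) + 4 * (ε * (m * L))
        + (m * L / ε) ^ 2 * Real.sqrt (overlap (c n) (s n) + L / c n)))
      + (1 + Real.exp (2 * L)) * ((m * L / ε) ^ 2 * (c n : ℝ)⁻¹), ?_, ?_⟩
  · filter_upwards [h2, hL, hc.eventually_ge_atTop 1] with n hn2 hnL hnc
    exact norm_expect_cexp_sub_le hnc (s n) (θ n) hn2 (hm n) hε hΘ (hθ n) hnL
  · have hsqrt : Tendsto (fun n => Real.sqrt (overlap (c n) (s n) + L / c n)) atTop (𝓝 0) := by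
      have := (hD.add (hcinv.const_mul L)).sqrt
      simpa [div_eq_mul_inv] using this
    have h1 := ((((hD.const_mul 2).add_const (4 * (ε * (m * L)))).add
      (hsqrt.const_mul ((m * L / ε) ^ 2))).const_mul Θ).const_mul (Real.exp (4 * L))
    have h3 := h1.add ((hcinv.const_mul ((m * L / ε) ^ 2)).const_mul (1 + Real.exp (2 * L)))
    convert h3 using 2
    ring

variable {E : Type*} [Fintype E] [DecidableEq E] {c : ℕ}

/-- The expected number of pairs of monochromatic members of two families that share at least two
edges. -/
noncomputable def crossOverlap {A B : Type*} [Fintype A] [Fintype B] (c : ℕ) (s : A → Finset E)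
    (t : B → Finset E) : ℝ :=
  ∑ α, ∑ β with 2 ≤ #(s α ∩ t β), 𝔼 χ, monoInd (c := c) (s α) χ * monoInd (t β) χ

lemma overlap_sigma_le {I : Type*} [Fintype I] [DecidableEq I] {A : I → Type*}
    [∀ i, Fintype (A i)] [∀ i, DecidableEq (A i)] (s : ∀ i, A i → Finset E) :
    overlap c (fun x : Σ i, A i => s x.1 x.2)
      ≤ ∑ i, ∑ j, if i = j then overlap c (s i) else crossOverlap c (s i) (s j) := by
  rw [overlap, Fintype.sum_sigma]
  refine sum_le_sum fun i _ => ?_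
  have h1 : ∀ α : A i, ∑ y : Σ i, A i with y ≠ ⟨i, α⟩ ∧ 2 ≤ #(s i α ∩ s y.1 y.2),
      𝔼 χ, monoInd (c := c) (s i α) χ * monoInd (s y.1 y.2) χ
      = ∑ j, ∑ β : A j, if (⟨j, β⟩ : Σ i, A i) ≠ ⟨i, α⟩ ∧ 2 ≤ #(s i α ∩ s j β) then
        𝔼 χ, monoInd (c := c) (s i α) χ * monoInd (s j β) χ else 0 := fun α => by
    rw [sum_filter, Fintype.sum_sigma]
  rw [sum_congr rfl fun α _ => h1 α, sum_comm]
  refine sum_le_sum fun j _ => ?_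
  split_ifs with hij
  · subst hij
    refine le_of_eq ?_
    rw [overlap]
    refine sum_congr rfl fun α _ => ?_
    rw [sum_filter]
    refine sum_congr rfl fun β _ => ?_
    simp
  · refine sum_le_sum fun α _ => ?_
    rw [sum_filter]
    refine sum_le_sum fun β _ => ?_
    have := expect_mul_nonneg (c := c) (s i α) (s j β)
    split_ifs with h3 h4 h4
    · exact le_rfl
    · exact absurd h3.2 h4
    · exact this
    · exact le_rfl

end Limit

/-! ### From random colorings to averages over colorings -/

section Transfer

open scoped BigOperators

variable {V W Ω : Type*} [MeasurableSpace Ω] {P : Measure Ω} [IsProbabilityMeasure P]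
  {G : SimpleGraph V} {c : ℕ} {X : G.edgeSet → Ω → Fin c}

omit [IsProbabilityMeasure P] in
lemma IsUniformEdgeColoring.measurable_comp {α : Type*} [MeasurableSpace α] [Finite G.edgeSet]
    (hX : IsUniformEdgeColoring P G c X) (φ : (G.edgeSet → Fin c) → α) :
    Measurable fun ω => φ fun e => X e ω :=
  (measurable_of_finite φ).comp (measurable_pi_lambda _ hX.measurable)

/-- Expectations under a uniform random coloring are averages over all colorings. -/
lemma IsUniformEdgeColoring.integral_comp {K : Type*} [RCLike K] [Fintype G.edgeSet]
    [DecidableEq G.edgeSet]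
    (hX : IsUniformEdgeColoring P G c X) (φ : (G.edgeSet → Fin c) → K) :
    ∫ ω, φ (fun e => X e ω) ∂P = 𝔼 χ, φ χ := by
  have hm : Measurable fun ω e => X e ω := measurable_pi_lambda _ hX.measurable
  have hmap : P.map (fun ω e => X e ω) = Measure.pi fun e => P.map (X e) :=
    (iIndepFun_iff_map_fun_eq_pi_map fun e => (hX.measurable e).aemeasurable).1 hX.indep
  have hprob : ∀ e, IsProbabilityMeasure (P.map (X e)) := fun e =>
    Measure.isProbabilityMeasure_map (hX.measurable e).aemeasurable
  have hsing : ∀ χ : G.edgeSet → Fin c, (P.map (fun ω e => X e ω)).real {χ}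
      = ((c : ℝ)⁻¹) ^ Fintype.card G.edgeSet := by
    intro χ
    rw [hmap, Measure.real, Measure.pi_singleton, ENNReal.toReal_prod]
    have : ∀ e, (P.map (X e) {χ e}).toReal = (c : ℝ)⁻¹ := fun e => by
      rw [Measure.map_apply (hX.measurable e) (measurableSet_singleton _), ← one_div]
      exact hX.uniform e (χ e)
    simp [this]
  have hfin : IsFiniteMeasure (P.map (fun ω e => X e ω)) := by rw [hmap]; infer_instance
  rw [← integral_map (f := φ) hm.aemeasurable (measurable_of_finite φ).aestronglyMeasurable,
    integral_fintype Integrable.of_finite]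
  simp only [hsing]
  rw [← Finset.smul_sum, Finset.expect_eq_sum_div_card, RCLike.real_smul_eq_coe_mul]
  simp [div_eq_inv_mul]

lemma isMonochromatic_iff [Fintype G.edgeSet] (χ : G.edgeSet → Fin c) (H : G.Subgraph) :
    IsMonochromatic χ H ↔ Mono (edgeFin H) χ := by
  unfold IsMonochromatic Mono
  simp only [mem_edgeFin]
  exact ⟨fun h e he e' he' => h e e' he he', fun h e e' he he' => h e he e' he'⟩

lemma R_eq_sum [Finite V] [Fintype G.edgeSet] [DecidableEq G.edgeSet] (F : SimpleGraph W)
    (χ : G.edgeSet → Fin c) :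
    (R F G χ : ℝ) = ∑ H : Copies F G, monoInd (edgeFin H.1) χ := by
  classical
  unfold monoInd
  have hinj : Function.Injective fun H : Copies F G => H.1 := Subtype.val_injective
  rw [Finset.sum_boole, R, ← Set.ncard_coe_finset, ← Set.ncard_image_of_injective _ hinj]
  congr 2
  ext H
  simp only [monochromaticCopies, Set.mem_ofPred_eq, Set.mem_image, Finset.coe_filter,
    Finset.mem_univ, true_and]
  constructor
  · rintro ⟨h1, h2⟩
    exact ⟨⟨H, h1⟩, (isMonochromatic_iff χ H).1 h2, rfl⟩
  · rintro ⟨H', h2, rfl⟩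
    exact ⟨H'.2, (isMonochromatic_iff χ _).2 h2⟩

lemma IsUniformEdgeColoring.integral_R [Finite V] [Fintype G.edgeSet] [DecidableEq G.edgeSet]
    (hX : IsUniformEdgeColoring P G c X) (F : SimpleGraph W) :
    ∫ ω, (R F G (fun e => X e ω) : ℝ) ∂P
      = 𝔼 χ : G.edgeSet → Fin c, ∑ H : Copies F G, monoInd (edgeFin H.1) χ := by
  rw [hX.integral_comp (fun χ => (R F G χ : ℝ))]
  exact Finset.expect_congr rfl fun χ _ => R_eq_sum F χ

lemma IsUniformEdgeColoring.variance_R [Finite V] [Fintype G.edgeSet] [DecidableEq G.edgeSet]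
    (hX : IsUniformEdgeColoring P G c X) (F : SimpleGraph W) :
    variance (fun ω => (R F G (fun e => X e ω) : ℝ)) P
      = 𝔼 χ : G.edgeSet → Fin c, (∑ H : Copies F G, monoInd (edgeFin H.1) χ) ^ 2
        - (𝔼 χ : G.edgeSet → Fin c, ∑ H : Copies F G, monoInd (edgeFin H.1) χ) ^ 2 := by
  rw [variance_eq_sub, hX.integral_R F]
  · congr 1
    simp only [Pi.pow_apply]
    rw [hX.integral_comp (fun χ => (R F G χ : ℝ) ^ 2)]
    exact Finset.expect_congr rfl fun χ _ => by rw [R_eq_sum F χ]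
  · refine MemLp.of_bound (hX.measurable_comp fun χ => (R F G χ : ℝ)).aestronglyMeasurable
      (∑ χ : G.edgeSet → Fin c, (R F G χ : ℝ)) (Eventually.of_forall fun ω => ?_)
    rw [Real.norm_of_nonneg (Nat.cast_nonneg _)]
    exact Finset.single_le_sum (f := fun χ : G.edgeSet → Fin c => (R F G χ : ℝ))
      (fun χ _ => Nat.cast_nonneg _) (Finset.mem_univ fun e => X e ω)

end Transfer

/-! ### Asymptotics of the overlaps along the sequence -/

section Sequences

open scoped BigOperators

variable {W : Type*} {F : SimpleGraph W} {V : ℕ → Type*} [∀ n, Finite (V n)]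
  {G : ∀ n, SimpleGraph (V n)} [∀ n, Fintype (G n).edgeSet] [∀ n, DecidableEq (G n).edgeSet]
  {c : ℕ → ℕ} {l : ℝ}

/-- A graph with at most one edge has no copies if its number of monochromatic copies has the same
asymptotic mean and variance. -/
lemma eventually_isEmpty_copies (hc : Tendsto c atTop atTop) (hF : Nat.card F.edgeSet ≤ 1)
    (hmean : Tendsto (fun n => 𝔼 χ : (G n).edgeSet → Fin (c n),
      ∑ H : Copies F (G n), monoInd (edgeFin H.1) χ) atTop (𝓝 l))
    (hvar : Tendsto (fun n => 𝔼 χ : (G n).edgeSet → Fin (c n),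
      (∑ H : Copies F (G n), monoInd (edgeFin H.1) χ) ^ 2
      - (𝔼 χ : (G n).edgeSet → Fin (c n),
        ∑ H : Copies F (G n), monoInd (edgeFin H.1) χ) ^ 2) atTop (𝓝 l)) :
    ∀ᶠ n in atTop, IsEmpty (Copies F (G n)) := by
  have hsum : ∀ n (χ : (G n).edgeSet → Fin (c n)),
      ∑ H : Copies F (G n), monoInd (edgeFin H.1) χ = Fintype.card (Copies F (G n)) := by
    intro n χ
    have : ∀ H : Copies F (G n), monoInd (edgeFin H.1) χ = 1 := fun H => by
      have h1 : (edgeFin H.1).card ≤ 1 := by rwa [card_edgeFin]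
      have h2 : Mono (edgeFin H.1) χ := fun e he e' he' => by
        rw [Finset.card_le_one.1 h1 e he e' he']
      simp [monoInd, h2]
    simp [this]
  simp only [hsum] at hmean hvar
  have hconst : ∀ᶠ n in atTop, ∀ x : ℝ, 𝔼 _χ : (G n).edgeSet → Fin (c n), x = x := by
    filter_upwards [hc.eventually_ge_atTop 1] with n hn x
    have : Nonempty (Fin (c n)) := ⟨⟨0, hn⟩⟩
    exact Finset.expect_const Finset.univ_nonempty x
  -- The count is deterministic, so its variance is 0; the mean is then a natural number tending to
  -- 0.
  have hl : l = 0 := by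
    refine tendsto_nhds_unique hvar (tendsto_const_nhds.congr' ?_)
    filter_upwards [hconst] with n hn
    rw [hn, hn, sub_self]
  rw [hl] at hmean
  filter_upwards [hconst, hmean.eventually (gt_mem_nhds one_pos)] with n hn h1
  rw [hn] at h1
  have h0 : Fintype.card (Copies F (G n)) = 0 := by
    have : Fintype.card (Copies F (G n)) < 1 := by exact_mod_cast h1
    omega
  exact Fintype.card_eq_zero_iff.1 h0

/-- The equality of the limits of mean and variance is used here: the bound is 2(Var − E + E/c). -/
lemma tendsto_overlap [∀ n, DecidableEq (Copies F (G n))] (hc : Tendsto c atTop atTop)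
    (hF : 2 ≤ Nat.card F.edgeSet)
    (hmean : Tendsto (fun n => 𝔼 χ : (G n).edgeSet → Fin (c n),
      ∑ H : Copies F (G n), monoInd (edgeFin H.1) χ) atTop (𝓝 l))
    (hvar : Tendsto (fun n => 𝔼 χ : (G n).edgeSet → Fin (c n),
      (∑ H : Copies F (G n), monoInd (edgeFin H.1) χ) ^ 2
      - (𝔼 χ : (G n).edgeSet → Fin (c n),
        ∑ H : Copies F (G n), monoInd (edgeFin H.1) χ) ^ 2) atTop (𝓝 l)) :
    Tendsto (fun n => overlap (c n) fun H : Copies F (G n) => edgeFin H.1) atTop (𝓝 0) := by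
  have hlim := ((hvar.sub hmean).add (hmean.mul (tendsto_inv_natCast hc))).const_mul 2
  rw [sub_self, mul_zero, add_zero, mul_zero] at hlim
  refine squeeze_zero' (Eventually.of_forall fun n => overlap_nonneg _) ?_ hlim
  filter_upwards [hc.eventually_ge_atTop 2] with n hn
  exact overlap_le_of_variance hn (fun H : Copies F (G n) => edgeFin H.1)
    (fun H => by rwa [card_edgeFin])

variable {W' : Type*} {F' : SimpleGraph W'} {l' : ℝ}

lemma tendsto_crossOverlap [Finite W] [Finite W'] (hc : Tendsto c atTop atTop)
    (hFF' : IsEmpty (F ≃g F'))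
    [∀ n, DecidableEq (Copies F (G n))] [∀ n, DecidableEq (Copies F' (G n))]
    (hF : 2 ≤ Nat.card F.edgeSet) (hF' : 2 ≤ Nat.card F'.edgeSet)
    (hmean : Tendsto (fun n => ∑ H : Copies F (G n), monoProb (c n) (edgeFin H.1)) atTop (𝓝 l))
    (hmean' : Tendsto (fun n => ∑ H : Copies F' (G n), monoProb (c n) (edgeFin H.1))
      atTop (𝓝 l'))
    (ho : Tendsto (fun n => overlap (c n) fun H : Copies F (G n) => edgeFin H.1) atTop (𝓝 0))
    (ho' : Tendsto (fun n => overlap (c n) fun H : Copies F' (G n) => edgeFin H.1)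
      atTop (𝓝 0)) :
    Tendsto (fun n => crossOverlap (c n) (fun H : Copies F (G n) => edgeFin H.1)
      (fun H : Copies F' (G n) => edgeFin H.1)) atTop (𝓝 0) := by
  have hci := tendsto_inv_natCast hc
  set a := Nat.card F.edgeSet
  set b := Nat.card F'.edgeSet
  set M := max (Nat.card W) (Nat.card W')
  have h1 := (((ho.add (hci.mul hmean)).const_mul (2 ^ a)).mul
    ((ho'.add (hmean'.const_mul 1)).const_mul (2 ^ b))).sqrt
  have h2 := (((ho'.add (hci.mul hmean')).const_mul (2 ^ b)).mul
    ((ho.add (hmean.const_mul 1)).const_mul (2 ^ a))).sqrt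
  have h3 := (hci.const_mul (((2 : ℝ) ^ (M + M * M)) ^ 2)).add (ho.add ho')
  have hlim := (h1.add h2).add h3
  simp only [zero_mul, mul_zero, add_zero, Real.sqrt_zero] at hlim
  refine squeeze_zero' (Eventually.of_forall fun n => Finset.sum_nonneg fun _ _ =>
    Finset.sum_nonneg fun _ _ => expect_mul_nonneg _ _) ?_ hlim
  filter_upwards [hc.eventually_ge_atTop 1] with n hn
  refine (cross_le hn (fun H : Copies F (G n) => edgeFin H.1)
    (fun H : Copies F' (G n) => edgeFin H.1) (fun H => card_edgeFin H) (fun H => card_edgeFin H)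
    hF hF').trans (add_le_add le_rfl ?_)
  exact coincidence_le hFF' (G n) hn hF hF' (le_max_left _ _) (le_max_right _ _)

end Sequences

/-! ### Characteristic functions and convergence in distribution -/

section CharFun

open scoped BigOperators

lemma charFun_map_toLp {Ω : Type*} [MeasurableSpace Ω] {P : Measure Ω} {ι : Type*}
    [Fintype ι] (Y : Ω → ι → ℝ) (hY : Measurable Y) (t : EuclideanSpace ℝ ι) :
    charFun (P.map fun ω => WithLp.toLp 2 (Y ω)) t
      = ∫ ω, Complex.exp ((∑ i, t i * Y ω i : ℝ) * Complex.I) ∂P := by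
  rw [charFun_apply, integral_map (by fun_prop) (by fun_prop)]
  simp [PiLp.inner_apply]

lemma charFun_poisson {Ω : Type*} [MeasurableSpace Ω] {Q : Measure Ω} [IsProbabilityMeasure Q]
    {ι : Type*} [Fintype ι] {Z : ι → Ω → ℕ} {l : ι → ℝ≥0}
    (hZ : ∀ i, HasLaw (Z i) (poissonMeasure (l i)) Q) (hind : iIndepFun Z Q)
    (t : EuclideanSpace ℝ ι) :
    charFun (Q.map fun ω => WithLp.toLp 2 fun i => (Z i ω : ℝ)) t
      = Complex.exp (∑ i, (l i : ℂ) * (Complex.exp (t i * Complex.I) - 1)) := by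
  have hm : ∀ i, AEMeasurable (fun ω => (Z i ω : ℝ)) Q := fun i =>
    measurable_from_nat.comp_aemeasurable (hZ i).aemeasurable
  have hind' : iIndepFun (fun i ω => (Z i ω : ℝ)) Q :=
    hind.comp (fun _ => (Nat.cast : ℕ → ℝ)) fun _ => measurable_from_nat
  rw [(iIndepFun_iff_charFun_pi hm).1 hind' t, Complex.exp_sum]
  refine Finset.prod_congr rfl fun i _ => ?_
  rw [← charFun_map_cast_poissonMeasure, ← (hZ i).map_eq,
    AEMeasurable.map_map_of_aemeasurable measurable_from_nat.aemeasurable (hZ i).aemeasurable]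
  rfl

/-- Convergence in distribution of random vectors from convergence of characteristic functions. -/
lemma tendstoInDistribution_of_tendsto_charFun {ι : Type*} [Fintype ι] {Ω : ℕ → Type*}
    [∀ n, MeasurableSpace (Ω n)] {P : ∀ n, Measure (Ω n)} [∀ n, IsProbabilityMeasure (P n)]
    {Ω' : Type*} [MeasurableSpace Ω'] {Q : Measure Ω'} [IsProbabilityMeasure Q]
    {Y : ∀ n, Ω n → ι → ℝ} {Z : Ω' → ι → ℝ} (hY : ∀ n, AEMeasurable (Y n) (P n))
    (hZ : AEMeasurable Z Q)
    (h : ∀ t : EuclideanSpace ℝ ι,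
      Tendsto (fun n => charFun ((P n).map fun ω => WithLp.toLp 2 (Y n ω)) t) atTop
        (𝓝 (charFun (Q.map fun ω => WithLp.toLp 2 (Z ω)) t))) :
    TendstoInDistribution Y atTop Z P Q := by
  have h1 : TendstoInDistribution (fun n ω => WithLp.toLp 2 (Y n ω)) atTop
      (fun ω => WithLp.toLp 2 (Z ω)) P Q :=
    { forall_aemeasurable := fun n => by fun_prop
      aemeasurable_limit := by fun_prop
      tendsto := ProbabilityMeasure.tendsto_iff_tendsto_charFun.2 h }
  exact h1.continuous_comp (PiLp.continuous_ofLp 2 fun _ : ι => ℝ)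

end CharFun

end MonoCopies

/-! ### The joint Poisson limit -/

open MonoCopies

theorem corollary1p7 {d : ℕ} (hd : 1 ≤ d)
    -- a fixed finite collection of pairwise non-isomorphic finite graphs `F 1, …, F d`
    {W : Fin d → Type*} [∀ i, Finite (W i)] (F : ∀ i, SimpleGraph (W i))
    (hF : ∀ i j, i ≠ j → IsEmpty (F i ≃g F j))
    -- a sequence of finite graphs `G n`
    {V : ℕ → Type*} [∀ n, Finite (V n)] (G : ∀ n, SimpleGraph (V n))
    -- the numbers of colors, which tend to infinity
    (c : ℕ → ℕ) (hc : Tendsto c atTop atTop)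
    -- for each `n` a uniformly random coloring `X n` of the edges of `G n` with `c n` colors
    {Ω : ℕ → Type*} [∀ n, MeasurableSpace (Ω n)] (P : ∀ n, Measure (Ω n))
    [∀ n, IsProbabilityMeasure (P n)]
    (X : ∀ n, (G n).edgeSet → Ω n → Fin (c n))
    (hX : ∀ n, MonoCopies.IsUniformEdgeColoring (P n) (G n) (c n) (X n))
    -- means and variances converge to `l i`
    (l : Fin d → ℝ≥0)
    (hmean : ∀ i, Tendsto
      (fun n => ∫ ω, (MonoCopies.R (F i) (G n) (fun e => X n e ω) : ℝ) ∂(P n))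
      atTop (𝓝 (l i : ℝ)))
    (hvar : ∀ i, Tendsto
      (fun n => variance (fun ω => (MonoCopies.R (F i) (G n) (fun e => X n e ω) : ℝ)) (P n))
      atTop (𝓝 (l i : ℝ)))
    -- independent Poisson random variables `Z i` with means `l i`
    {Ω' : Type*} [MeasurableSpace Ω'] (Q : Measure Ω') [IsProbabilityMeasure Q]
    (Z : Fin d → Ω' → ℕ) (hZ : ∀ i, HasLaw (Z i) (poissonMeasure (l i)) Q)
    (hZind : iIndepFun Z Q) :
    TendstoInDistribution
      (fun n ω (i : Fin d) => (MonoCopies.R (F i) (G n) (fun e => X n e ω) : ℝ)) atTop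
      (fun ω (i : Fin d) => (Z i ω : ℝ)) P Q := by
  classical
  have : ∀ n, Fintype (G n).edgeSet := fun n => Fintype.ofFinite _
  simp only [fun i n => (hX n).integral_R (F i)] at hmean
  simp only [fun i n => (hX n).variance_R (F i)] at hvar
  have hsmall : ∀ᶠ n in atTop, ∀ i, Nat.card (F i).edgeSet ≤ 1 → IsEmpty (Copies (F i) (G n)) := by
    refine eventually_all.2 fun i => ?_
    by_cases hi : Nat.card (F i).edgeSet ≤ 1
    · filter_upwards [eventually_isEmpty_copies hc hi (hmean i) (hvar i)] with n hn _ using hn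
    · exact Eventually.of_forall fun n h => absurd h hi
  -- All copies of all the graphs now form a single family, in which every member eventually has two
  -- edges.
  have h2 : ∀ᶠ n in atTop, ∀ x : Σ i, Copies (F i) (G n), 2 ≤ (edgeFin x.2.1).card := by
    filter_upwards [hsmall] with n hn x
    by_contra hlt
    rw [card_edgeFin] at hlt
    exact (hn x.1 (by omega)).false x.2
  have hprob : ∀ i, Tendsto (fun n => ∑ H : Copies (F i) (G n), monoProb (c n) (edgeFin H.1))
      atTop (𝓝 (l i : ℝ)) := by
    intro i
    refine (hmean i).congr' ?_
    filter_upwards [h2, hc.eventually_ge_atTop 1] with n hn hcn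
    rw [Finset.expect_sum_comm]
    exact Finset.sum_congr rfl fun H _ => expect_monoInd hcn
      (Finset.card_pos.1 (by have : 2 ≤ (edgeFin H.1).card := hn ⟨i, H⟩; omega))
  have hover : Tendsto (fun n => overlap (c n)
      fun x : Σ i, Copies (F i) (G n) => edgeFin x.2.1) atTop (𝓝 0) := by
    have hij : ∀ i j, Tendsto (fun n => if i = j then
        overlap (c n) (fun H : Copies (F i) (G n) => edgeFin H.1) else
        crossOverlap (c n) (fun H : Copies (F i) (G n) => edgeFin H.1)
          (fun H : Copies (F j) (G n) => edgeFin H.1)) atTop (𝓝 0) := by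
      intro i j
      by_cases hi : Nat.card (F i).edgeSet ≤ 1
      · refine tendsto_const_nhds.congr' ?_
        filter_upwards [hsmall] with n hn
        have := hn i hi
        simp [overlap, crossOverlap]
      by_cases hj : Nat.card (F j).edgeSet ≤ 1
      · refine tendsto_const_nhds.congr' ?_
        filter_upwards [hsmall] with n hn
        have := hn j hj
        have hne : i ≠ j := fun h => hi (h ▸ hj)
        simp [hne, crossOverlap, Finset.univ_eq_empty]
      have hoi := tendsto_overlap hc (by omega) (hmean i) (hvar i)
      have hoj := tendsto_overlap hc (by omega) (hmean j) (hvar j)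
      split_ifs with h
      · exact hoi
      · exact tendsto_crossOverlap hc (hF i j h) (by omega) (by omega) (hprob i) (hprob j) hoi hoj
    have hlim := tendsto_finsetSum Finset.univ fun i _ =>
      tendsto_finsetSum Finset.univ fun j _ => hij i j
    simp only [Finset.sum_const_zero] at hlim
    exact squeeze_zero (fun n => overlap_nonneg _)
      (fun n => overlap_sigma_le fun i (H : Copies (F i) (G n)) => edgeFin H.1) hlim
  have hL : ∀ᶠ n in atTop, ∑ x : Σ i, Copies (F i) (G n), monoProb (c n) (edgeFin x.2.1)
      ≤ ∑ i, (l i : ℝ) + 1 := by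
    have := tendsto_finsetSum Finset.univ fun i _ => hprob i
    filter_upwards [this.eventually (gt_mem_nhds (lt_add_one _))] with n hn
    rw [Fintype.sum_sigma]
    exact hn.le
  refine tendstoInDistribution_of_tendsto_charFun
    (fun n => ((hX n).measurable_comp fun χ i => (R (F i) (G n) χ : ℝ)).aemeasurable)
    (aemeasurable_pi_lambda _ fun i => measurable_from_nat.comp_aemeasurable (hZ i).aemeasurable)
    fun t => ?_
  rw [charFun_poisson hZ hZind]
  -- With weight `t i` on each copy of `F i`, the weighted count is the inner product of `t` with
  -- the vector of counts.
  have hmain := tendsto_expect_cexp_sub hc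
    (fun n (x : Σ i, Copies (F i) (G n)) => edgeFin x.2.1) (fun n x => t x.1)
    (Θ := ∑ i, |t i|) (L := ∑ i, (l i : ℝ) + 1) (m := ∑ i, Nat.card (F i).edgeSet)
    (Finset.sum_nonneg fun i _ => abs_nonneg _) (by positivity)
    (fun n x => Finset.single_le_sum (f := fun i => |t i|) (fun i _ => abs_nonneg _)
      (Finset.mem_univ x.1)) h2
    (fun n x => by
      rw [card_edgeFin]
      exact Finset.single_le_sum (f := fun i => Nat.card (F i).edgeSet)
        (fun i _ => Nat.zero_le _) (Finset.mem_univ x.1)) hL hover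
  have hexp : Tendsto (fun n => Complex.exp (∑ x : Σ i, Copies (F i) (G n),
      monoProb (c n) (edgeFin x.2.1) * (Complex.exp (t x.1 * Complex.I) - 1))) atTop
      (𝓝 (Complex.exp (∑ i, (l i : ℂ) * (Complex.exp (t i * Complex.I) - 1)))) := by
    refine (Complex.continuous_exp.tendsto _).comp ?_
    simp only [Fintype.sum_sigma, ← Finset.sum_mul]
    refine tendsto_finsetSum _ fun i _ => Tendsto.mul_const _ ?_
    have := (Complex.continuous_ofReal.tendsto _).comp (hprob i)
    simpa [Function.comp_def] using this
  have hsum := hmain.add hexp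
  simp only [sub_add_cancel, zero_add] at hsum
  refine hsum.congr fun n => ?_
  rw [charFun_map_toLp _ ((hX n).measurable_comp fun χ i => (R (F i) (G n) χ : ℝ)),
    (hX n).integral_comp fun χ =>
      Complex.exp ((∑ i, t i * (R (F i) (G n) χ : ℝ) : ℝ) * Complex.I)]
  refine Finset.expect_congr rfl fun χ _ => ?_
  simp only [wsum, Fintype.sum_sigma, R_eq_sum, Finset.mul_sum]
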